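/- **Setting.** Let $\mathcal X$ be a measurable space with a reference measure $dx$, let $c:\mathcal X\to[0,\infty)$ and $\phi=(\phi_1,\dots,\phi_d):\mathcal X\to\mathbb R^d$ be measurable, and consider the exponential family $$p_\theta(x)=c(x)\,e^{\theta\cdot\phi(x)-\Lambda(\theta)},\qquad \Lambda(\theta)=\log\int_{\mathcal X}c(x)e^{\theta\cdot\phi(x)}\,dx,\qquad \theta\in\Theta\subset\mathbb R^d,$$ with true parameter $\theta^*$, where $0<\int c(x)e^{\theta^*\cdot\phi(x)}dx<\infty$. Assume: * $|\phi_j(x)|\le C$ for all $x\in\mathcal X$ and $1\le j\le d$; * $\Theta$ is compact and convex, and $\theta^*$ is an interior point of $\Theta$; * for every $\theta\in\Theta$, the functions $\phi_1,\dots,\phi_d$ are linearly independent under $p_\theta$ (no nontrivial linear combination vanishes $p_\theta$-almost surely); * for every $\theta\in\Theta$, $k_\theta$ is a Markov transition kernel on $\mathcal X$ with invariant law $p_\theta$, and its Markov operator has an $L^2(p_\theta)$-spectral gap $1-\alpha(\theta)>0$, where $\alpha(\theta)$ is the operator norm of $f\mapsto\int f(y)k_\theta(\cdot,dy)$ on the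 mean-zero functions in $L^2(p_\theta)$; moreover $\alpha:=\sup_{\theta\in\Theta}\alpha(\theta)<1$. Let $\lambda=\inf_{\theta\in\Theta}\lambda(\theta)$, where $\lambda(\theta)$ is the smallest eigenvalue of $\nabla^2\Lambda(\theta)=\mathrm{Cov}_\theta[\phi(X)]$, and let $L$ be the (least) Lipschitz constant on $\Theta$ of $$\theta\mapsto\sqrt{e^{-2\Lambda(\theta^*)+\Lambda(\theta)+\Lambda(2\theta^*-\theta)}-1}.$$ Let $m\in\mathbb N$ and $\gamma\in(0,1/2)$, let $\mathbf x=(x_1,\dots,x_n)$ be data with $c(x_i)>0$ for all $i$, and let $\hat\theta_n$ be a maximum likelihood estimate for $\mathbf x$ over $\Theta$. Suppose $\mathbf x$ satisfies the two constraints $$\sqrt n\,\|\hat\theta_n-\theta^*\|<n^\gamma,\qquad \sup_{\theta\in\Theta}\sqrt n\,\Big\|\frac1n\sum_{i=1}^n\int\phi(y)\,k_\theta^m(x_i,dy)-\int\phi(y)\,(k_\theta^mp_{\theta^*})(dy)\Big\|<n^\gamma .$$ Let $\eta_t\ge0$ be learning rates, let $\partial\Theta_t=\{\theta\in\Theta:\operatorname{dist}(\theta,\partial\Theta)\le2\eta_t\sqrt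 d\,C\}$, and let $(\theta_t)_{t\ge0}$ be generated by CD-$m$ on $\mathbf x$, started at a (possibly random) $\theta_0\in\Theta$: given $\theta_0,\dots,\theta_t$, the variables $X_1^{(m)},\dots,X_n^{(m)}$ are independent with $X_i^{(m)}\sim k_{\theta_t}^m(x_i,\cdot)$, and $$\theta_{t+1}=\theta_t+\eta_t\Big[\frac1n\sum_{i=1}^n\phi(x_i)-\frac1n\sum_{i=1}^n\phi(X_i^{(m)})\Big]\mathbf 1(\theta_t\notin\partial\Theta_t).$$ Write $\mathbb E^{\mathbf x}$ for expectation under the law of this process. **Lemma.** Let $h(\theta)=\|\theta-\hat\theta_n\|$. Then for every $t\ge0$ the variable $h^2(\theta_{t+1})$ is integrable and, almost surely, $$\mathbb E^{\mathbf x}[h^2(\theta_{t+1})\mid\theta_t]\le h^2(\theta_t)-2\eta_t\big[a_mh^2(\theta_t)-b_{n,m}h(\theta_t)\big]\mathbf 1(\theta_t\notin\partial\Theta_t)+4d\,\eta_t^2C^2,$$ where $$a_m=\lambda-\sqrt d\,C L\alpha^m,\qquad b_{n,m}=(1+\sqrt d\,CL\alpha^m)\,n^{-1/2+\gamma}.$$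 -/

import Mathlib

open MeasureTheory ProbabilityTheory
open scoped NNReal ENNReal

namespace CD

noncomputable section

/-- The parameter space `ℝ^d` with its Euclidean norm. -/
abbrev Par (d : ℕ) : Type := EuclideanSpace ℝ (Fin d)

section ExponentialFamily

variable {𝒳 : Type*} [MeasurableSpace 𝒳] {d : ℕ}

/-- The log-partition function `Λ(θ) = log ∫ c(x) exp(θ · φ(x)) dx`, where `dx` is the reference
measure `ref` (for instance Lebesgue or counting measure), `c` the carrier and `φ` the sufficient
statistic. -/
def logPartition (ref : Measure 𝒳) (c : 𝒳 → ℝ) (φ : 𝒳 → Par d) (θ : Par d) : ℝ :=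
  Real.log (∫ x, c x * Real.exp (inner ℝ θ (φ x)) ∂ref)

/-- The density `p_θ(x) = c(x) exp(θ · φ(x) - Λ(θ))`. -/
def density (ref : Measure 𝒳) (c : 𝒳 → ℝ) (φ : 𝒳 → Par d) (θ : Par d) (x : 𝒳) : ℝ :=
  c x * Real.exp (inner ℝ θ (φ x) - logPartition ref c φ θ)

/-- The law on `𝒳` with density `p_θ` with respect to the reference measure. -/
def law (ref : Measure 𝒳) (c : 𝒳 → ℝ) (φ : 𝒳 → Par d) (θ : Par d) : Measure 𝒳 :=
  ref.withDensity (fun x => ENNReal.ofReal (density ref c φ θ x))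

/-- `θhat` is a maximum likelihood estimate, over the parameter space `Θ`, for the data `x`. -/
def IsMLE (ref : Measure 𝒳) (c : 𝒳 → ℝ) (φ : 𝒳 → Par d) (Θ : Set (Par d)) {n : ℕ}
    (x : Fin n → 𝒳) (θhat : Par d) : Prop :=
  θhat ∈ Θ ∧ IsMaxOn (fun θ => ∏ i, density ref c φ θ (x i)) Θ θhat

/-- The covariance matrix `Cov_θ[φ(X)]`, `X ∼ p_θ`. -/
def covMatrix (ref : Measure 𝒳) (c : 𝒳 → ℝ) (φ : 𝒳 → Par d) (θ : Par d) :
    Matrix (Fin d) (Fin d) ℝ :=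
  Matrix.of fun i j => cov[fun x => φ x i, fun x => φ x j; law ref c φ θ]

/-- The smallest eigenvalue of a (symmetric) real matrix. -/
def smallestEigenvalue (M : Matrix (Fin d) (Fin d) ℝ) : ℝ := sInf (spectrum ℝ M)

/-- `λ = inf_{θ ∈ Θ} λ(θ)`, where `λ(θ)` is the smallest eigenvalue of `Cov_θ[φ(X)]`. -/
def lam (ref : Measure 𝒳) (c : 𝒳 → ℝ) (φ : 𝒳 → Par d) (Θ : Set (Par d)) : ℝ :=
  sInf ((fun θ => smallestEigenvalue (covMatrix ref c φ θ)) '' Θ)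

/-- The function `θ ↦ √(exp(-2Λ(θ*) + Λ(θ) + Λ(2θ* - θ)) - 1)`. -/
def chiFun (ref : Measure 𝒳) (c : 𝒳 → ℝ) (φ : 𝒳 → Par d) (θstar θ : Par d) : ℝ :=
  Real.sqrt (Real.exp (-2 * logPartition ref c φ θstar + logPartition ref c φ θ
    + logPartition ref c φ ((2 : ℝ) • θstar - θ)) - 1)

/-- The (least) Lipschitz constant `L` of `chiFun` on `Θ`. -/
def lipConst (ref : Measure 𝒳) (c : 𝒳 → ℝ) (φ : 𝒳 → Par d) (Θ : Set (Par d))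
    (θstar : Par d) : ℝ :=
  ((sInf {K : ℝ≥0 | LipschitzOnWith K (chiFun ref c φ θstar) Θ} : ℝ≥0) : ℝ)

end ExponentialFamily

section MarkovOperator

variable {𝒳 : Type*} [MeasurableSpace 𝒳]

/-- For a Markov kernel `κ` with invariant law `π`: the norm of the Markov operator
`f ↦ ∫ f(y) κ(·, dy)` on the mean-zero functions in `L²(π)`, that is, the least `a ≥ 0` with
`‖κ f - π f‖ ≤ a ‖f - π f‖` in `L²(π)` for all `f ∈ L²(π)`. The `L²`-spectral gap of `κ` is
`1` minus this number. -/
def l2Contraction (κ : Kernel 𝒳 𝒳) (π : Measure 𝒳) : ℝ :=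
  sInf {a : ℝ | 0 ≤ a ∧ ∀ f : 𝒳 → ℝ, MemLp f 2 π →
    eLpNorm (fun x => ∫ y, f y ∂(κ x) - ∫ y, f y ∂π) 2 π ≤
      ENNReal.ofReal a * eLpNorm (fun x => f x - ∫ y, f y ∂π) 2 π}

/-- `α = sup_{θ ∈ Θ} α(θ)`, where `1 - α(θ)` is the `L²(p_θ)`-spectral gap of `k_θ`. -/
def alphaSup {d : ℕ} (ref : Measure 𝒳) (c : 𝒳 → ℝ) (φ : 𝒳 → Par d) (Θ : Set (Par d))
    (k : Par d → Kernel 𝒳 𝒳) : ℝ :=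
  sSup ((fun θ => l2Contraction (k θ) (law ref c φ θ)) '' Θ)

end MarkovOperator

section Algorithm

variable {𝒳 : Type*} [MeasurableSpace 𝒳] {d n : ℕ}

/-- `sup_{θ ∈ Θ} √n ‖(1/n) ∑ᵢ ∫ φ(y) k_θ^m(xᵢ, dy) - ∫ φ(y) (k_θ^m p_{θ*})(dy)‖`. -/
def empiricalDeviation (ref : Measure 𝒳) (c : 𝒳 → ℝ) (φ : 𝒳 → Par d) (Θ : Set (Par d))
    (θstar : Par d) (k : Par d → Kernel 𝒳 𝒳) (m : ℕ) (x : Fin n → 𝒳) : ℝ :=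
  sSup ((fun θ => Real.sqrt n *
    ‖(1 / (n : ℝ)) • ∑ i, ∫ y, φ y ∂((k θ ^ m) (x i))
      - ∫ y, φ y ∂((law ref c φ θstar).bind (k θ ^ m))‖) '' Θ)

/-- `∂Θ_t = {θ ∈ Θ : dist(θ, ∂Θ) ≤ 2 η √d C}` for the learning rate `η = η_t`. -/
def boundaryLayer (Θ : Set (Par d)) (C η : ℝ) : Set (Par d) :=
  {θ | θ ∈ Θ ∧ Metric.infDist θ (frontier Θ) ≤ 2 * η * Real.sqrt d * C}

/-- The CD gradient `(1/n) ∑ᵢ φ(xᵢ) - (1/n) ∑ᵢ φ(yᵢ)`, with `yᵢ` in the role of `Xᵢ^{(m)}`. -/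
def cdGradient (φ : 𝒳 → Par d) (x y : Fin n → 𝒳) : Par d :=
  (1 / (n : ℝ)) • ∑ i, φ (x i) - (1 / (n : ℝ)) • ∑ i, φ (y i)

/-- The parameters `θ_t` and the samples `Y_t = (X₁^{(m)}, …, X_n^{(m)})` drawn in step `t`
form a run of CD-`m`, with learning rates `η_t`, on the fixed data `x` under `P` (which is then
the conditional law `P^x`): given `θ_0, …, θ_t`, the coordinates of `Y_t` are independent with
laws `k_{θ_t}^m(xᵢ, ·)`, and `θ_{t+1} = θ_t + η_t g_cd(θ_t) 1(θ_t ∉ ∂Θ_t)`. -/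
structure IsCDRun {Ω : Type*} [MeasurableSpace Ω] (P : Measure Ω)
    (φ : 𝒳 → Par d) (Θ : Set (Par d)) (C : ℝ) (k : Par d → Kernel 𝒳 𝒳) (m : ℕ)
    (η : ℕ → ℝ) (x : Fin n → 𝒳) (θ : ℕ → Ω → Par d) (Y : ℕ → Ω → Fin n → 𝒳) : Prop where
  measurable_param : ∀ t, Measurable (θ t)
  measurable_sample : ∀ t, Measurable (Y t)
  init_mem : ∀ ω, θ 0 ω ∈ Θ
  sample_law : ∀ t, ∀ A : Set (Fin n → 𝒳), MeasurableSet A →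
    P⟦Y t ⁻¹' A | ⨆ s ≤ t, MeasurableSpace.comap (θ s) inferInstance⟧ =ᵐ[P]
      fun ω => (Measure.pi fun i => (k (θ t ω) ^ m) (x i)).real A
  update : ∀ t ω, θ (t + 1) ω = θ t ω +
    (boundaryLayer Θ C (η t))ᶜ.indicator (fun _ => η t • cdGradient φ x (Y t ω)) (θ t ω)

/-- `a_m = λ - √d C L α^m`. -/
def aCoef (d m : ℕ) (l C L α : ℝ) : ℝ := l - Real.sqrt d * C * L * α ^ m

/-- `b_{n,m} = (1 + √d C L α^m) n^{-1/2+γ}`. -/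
def bCoef (d n m : ℕ) (C L α γ : ℝ) : ℝ :=
  (1 + Real.sqrt d * C * L * α ^ m) * (n : ℝ) ^ (-(1 / 2 : ℝ) + γ)

end Algorithm

end

end CD

namespace CD

/-! Write `h = ‖θ - θhat‖` and let `g` be the CD gradient. Expanding the square of the update leaves
a cross term `2η⟨θ - θhat, g⟩` and a remainder `η²‖g‖² ≤ 4dη²C²`, because `‖φ‖ ≤ √d C`. Everything
rests on the conditional mean of `g`, which splits into three parts, each paired with `θ - θhat`.

Likelihood: the mean of `φ(xᵢ)` minus the `p_θ`-mean of `φ` is the gradient of the averaged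
log-likelihood. This function is concave with modulus `λ` and maximal at `θhat`, so the pairing is
at most `-λh²` (`inner_likelihood_gradient_le`).

Bias: the chain of `k_θ` starts from `p_{θ*}` instead of `p_θ`. By Cauchy-Schwarz the error is at
most the `L²(p_θ)`-norm of the centred `k_θ^m f`, with `f = ⟨θ - θhat, φ⟩`, times the χ-distance
`chiFun` of `p_{θ*}` from `p_θ`. The spectral gap bounds the first factor by `α^m √d C h`; the
second is at most `L‖θ - θ*‖ ≤ L(h + n^{-1/2+γ})` (`integral_law_sub_integral_bind_le`,
`chiFun_le_lipConst_mul`).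

Noise: the second data constraint bounds the rest by `n^{-1/2+γ} h`. The sum is `-(a_m h² - b_{n,m}
h)` (`inner_expected_cdGradient_le`).

The bound needs `θ_t ∈ Θ`, which the boundary layer guarantees (`param_mem`). The mean of `g` is
taken given the whole past (`condExp_comp_eq_integral`); as the bound depends on `θ_t` alone, the
tower property finishes (`condExp_le_of_le_add_inner`). -/

/-- The standing hypotheses on an exponential family with a statistic bounded by `R`. -/
structure BoundedFamily {𝒳 : Type*} [MeasurableSpace 𝒳] {d : ℕ} (ref : Measure 𝒳) (c : 𝒳 → ℝ)
    (φ : 𝒳 → Par d) (R : ℝ) : Prop where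
  meas_c : Measurable c
  nonneg_c : ∀ x, 0 ≤ c x
  meas_stat : Measurable φ
  norm_le : ∀ x, ‖φ x‖ ≤ R
  exists_base : ∃ θ₀ : Par d, Integrable (fun x => c x * Real.exp (inner ℝ θ₀ (φ x))) ref ∧
    0 < ∫ x, c x * Real.exp (inner ℝ θ₀ (φ x)) ∂ref

/-! ### Integrability and change of parameter in the family. -/

namespace BoundedFamily

variable {𝒳 : Type*} [MeasurableSpace 𝒳] {d : ℕ} {ref : Measure 𝒳} {c : 𝒳 → ℝ}
  {φ : 𝒳 → Par d} {R : ℝ}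

lemma measurable_inner (h : BoundedFamily ref c φ R) (v : Par d) :
    Measurable fun x => inner ℝ v (φ x) := by
  have := h.meas_stat
  fun_prop

lemma abs_inner_le (h : BoundedFamily ref c φ R) (v : Par d) (x : 𝒳) :
    |inner ℝ v (φ x)| ≤ ‖v‖ * R :=
  (abs_real_inner_le_norm _ _).trans (mul_le_mul_of_nonneg_left (h.norm_le x) (norm_nonneg _))

/-- A bounded statistic makes all weights comparable, so finiteness and positivity at one parameter
spread to all of `ℝ^d`, including `2θ* - θ`, which may lie outside `Θ`. -/
lemma weight_le (h : BoundedFamily ref c φ R) (θ θ' : Par d) (x : 𝒳) :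
    c x * Real.exp (inner ℝ θ' (φ x)) ≤
      Real.exp (‖θ' - θ‖ * R) * (c x * Real.exp (inner ℝ θ (φ x))) := by
  have h1 : inner ℝ θ' (φ x) ≤ ‖θ' - θ‖ * R + inner ℝ θ (φ x) := by
    have := (abs_le.1 (h.abs_inner_le (θ' - θ) x)).2
    rw [inner_sub_left] at this
    linarith
  calc c x * Real.exp (inner ℝ θ' (φ x))
      ≤ c x * Real.exp (‖θ' - θ‖ * R + inner ℝ θ (φ x)) :=
        mul_le_mul_of_nonneg_left (Real.exp_le_exp.2 h1) (h.nonneg_c x)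
    _ = _ := by rw [Real.exp_add]; ring

lemma integrable_weight (h : BoundedFamily ref c φ R) (θ : Par d) :
    Integrable (fun x => c x * Real.exp (inner ℝ θ (φ x))) ref := by
  obtain ⟨θ₀, hi, -⟩ := h.exists_base
  refine (hi.const_mul (Real.exp (‖θ - θ₀‖ * R))).mono'
    (h.meas_c.mul (h.measurable_inner θ).exp).aestronglyMeasurable (ae_of_all _ fun x => ?_)
  rw [Real.norm_of_nonneg (mul_nonneg (h.nonneg_c x) (Real.exp_pos _).le)]
  exact h.weight_le θ₀ θ x

lemma integral_weight_pos (h : BoundedFamily ref c φ R) (θ : Par d) :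
    0 < ∫ x, c x * Real.exp (inner ℝ θ (φ x)) ∂ref := by
  obtain ⟨θ₀, hi, hp⟩ := h.exists_base
  have := integral_mono hi ((h.integrable_weight θ).const_mul _) (h.weight_le θ θ₀)
  rw [integral_const_mul] at this
  exact pos_of_mul_pos_right (hp.trans_le this) (Real.exp_pos _).le

lemma exp_logPartition (h : BoundedFamily ref c φ R) (θ : Par d) :
    Real.exp (logPartition ref c φ θ) = ∫ x, c x * Real.exp (inner ℝ θ (φ x)) ∂ref :=
  Real.exp_log (h.integral_weight_pos θ)

lemma measurable_density (h : BoundedFamily ref c φ R) (θ : Par d) :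
    Measurable (density ref c φ θ) :=
  h.meas_c.mul ((h.measurable_inner θ).sub_const _).exp

lemma density_nonneg (h : BoundedFamily ref c φ R) (θ : Par d) (x : 𝒳) :
    0 ≤ density ref c φ θ x :=
  mul_nonneg (h.nonneg_c x) (Real.exp_pos _).le

lemma density_eq (θ : Par d) (x : 𝒳) : density ref c φ θ x =
    Real.exp (-logPartition ref c φ θ) * (c x * Real.exp (inner ℝ θ (φ x))) := by
  rw [density, sub_eq_add_neg, Real.exp_add]; ring

lemma integral_law (h : BoundedFamily ref c φ R) (θ : Par d) (g : 𝒳 → ℝ) :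
    ∫ x, g x ∂law ref c φ θ = ∫ x, density ref c φ θ x * g x ∂ref := by
  rw [law, integral_withDensity_eq_integral_toReal_smul (h.measurable_density θ).ennreal_ofReal
    (by simp)]
  simp [ENNReal.toReal_ofReal, h.density_nonneg]

lemma isProbabilityMeasure_law (h : BoundedFamily ref c φ R) (θ : Par d) :
    IsProbabilityMeasure (law ref c φ θ) := by
  refine ⟨?_⟩
  rw [law, withDensity_apply _ MeasurableSet.univ, Measure.restrict_univ,
    ← ofReal_integral_eq_lintegral_ofReal _ (ae_of_all _ (h.density_nonneg θ))]
  · simp_rw [density_eq, integral_const_mul, ← h.exp_logPartition, ← Real.exp_add]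
    simp
  · simp_rw [funext (density_eq (ref := ref) (c := c) (φ := φ) θ)]
    exact (h.integrable_weight θ).const_mul _

lemma integral_law_change (h : BoundedFamily ref c φ R) (θ θ' : Par d) (g : 𝒳 → ℝ) :
    ∫ x, g x ∂law ref c φ θ' = ∫ x, Real.exp (inner ℝ (θ' - θ) (φ x)
      - logPartition ref c φ θ' + logPartition ref c φ θ) * g x ∂law ref c φ θ := by
  rw [h.integral_law, h.integral_law]
  refine integral_congr_ae (ae_of_all _ fun x => ?_)
  simp only [density]
  rw [← mul_assoc, mul_assoc (c x) _ (Real.exp _), ← Real.exp_add, inner_sub_left]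
  ring_nf

lemma integrable_of_bound (h : BoundedFamily ref c φ R) (θ : Par d) {g : 𝒳 → ℝ}
    (hg : Measurable g) {B : ℝ} (hB : ∀ x, |g x| ≤ B) : Integrable g (law ref c φ θ) :=
  have := h.isProbabilityMeasure_law θ
  Integrable.of_bound hg.aestronglyMeasurable B (ae_of_all _ hB)

lemma exp_logPartition_sub (h : BoundedFamily ref c φ R) (θ θ' : Par d) :
    Real.exp (logPartition ref c φ θ' - logPartition ref c φ θ) =
      ∫ x, Real.exp (inner ℝ (θ' - θ) (φ x)) ∂law ref c φ θ := by
  have := h.isProbabilityMeasure_law θ'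
  have h1 := h.integral_law_change θ θ' fun _ => 1
  have h2 : ∀ x, Real.exp (inner ℝ (θ' - θ) (φ x) - logPartition ref c φ θ'
      + logPartition ref c φ θ) * 1 = Real.exp (inner ℝ (θ' - θ) (φ x)) *
        Real.exp (-(logPartition ref c φ θ' - logPartition ref c φ θ)) := fun x => by
    rw [mul_one, ← Real.exp_add]
    ring_nf
  simp_rw [h2, integral_mul_const] at h1
  rw [integral_const, probReal_univ, one_smul, Real.exp_neg] at h1
  exact ((mul_inv_eq_one₀ (Real.exp_pos _).ne').1 h1.symm).symm

lemma logPartition_sub_le (h : BoundedFamily ref c φ R) (θ θ' : Par d) :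
    logPartition ref c φ θ' - logPartition ref c φ θ ≤ ‖θ' - θ‖ * R := by
  have := h.isProbabilityMeasure_law θ
  rw [← Real.exp_le_exp, h.exp_logPartition_sub]
  calc _ ≤ ∫ _, Real.exp (‖θ' - θ‖ * R) ∂law ref c φ θ := by
        refine integral_mono (h.integrable_of_bound θ (h.measurable_inner _).exp
          (B := Real.exp (‖θ' - θ‖ * R)) fun x => ?_) (integrable_const _) fun x => ?_
        · rw [abs_of_pos (Real.exp_pos _)]
          exact Real.exp_le_exp.2 (abs_le.1 (h.abs_inner_le (θ' - θ) x)).2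
        · exact Real.exp_le_exp.2 (abs_le.1 (h.abs_inner_le (θ' - θ) x)).2
    _ = _ := by simp

lemma abs_logPartition_sub_le (h : BoundedFamily ref c φ R) (θ θ' : Par d) :
    |logPartition ref c φ θ - logPartition ref c φ θ'| ≤ ‖θ - θ'‖ * R := by
  refine abs_le.2 ⟨?_, h.logPartition_sub_le θ' θ⟩
  have := h.logPartition_sub_le θ θ'
  rw [norm_sub_rev] at this
  linarith

/-! ### The log-partition function along a line -/

lemma integrableExpSet_inner (h : BoundedFamily ref c φ R) (θ v : Par d) :
    integrableExpSet (fun x => inner ℝ v (φ x)) (law ref c φ θ) = Set.univ := by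
  refine Set.eq_univ_of_forall fun s => ?_
  refine h.integrable_of_bound θ ((h.measurable_inner v).const_mul s).exp
    (B := Real.exp (‖s • v‖ * R)) fun x => ?_
  rw [abs_of_pos (Real.exp_pos _), ← real_inner_smul_left]
  exact Real.exp_le_exp.2 (abs_le.1 (h.abs_inner_le _ x)).2

lemma logPartition_line (h : BoundedFamily ref c φ R) (θ v : Par d) (s : ℝ) :
    logPartition ref c φ (θ + s • v) = logPartition ref c φ θ +
      cgf (fun x => inner ℝ v (φ x)) (law ref c φ θ) s := by
  have h1 := h.exp_logPartition_sub θ (θ + s • v)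
  simp only [add_sub_cancel_left, real_inner_smul_left] at h1
  rw [cgf, mgf, ← h1, Real.log_exp]
  ring

/-- Rebasing the family at `θ + s • v` moves `s` to the origin of a cumulant generating function,
whose derivative there is the mean. -/
lemma hasDerivAt_logPartition_line (h : BoundedFamily ref c φ R) (θ v : Par d) (s : ℝ) :
    HasDerivAt (fun s => logPartition ref c φ (θ + s • v))
      (∫ x, inner ℝ v (φ x) ∂law ref c φ (θ + s • v)) s := by
  have := h.isProbabilityMeasure_law (θ + s • v)
  have hm : (0 : ℝ) ∈ interior (integrableExpSet (fun x => inner ℝ v (φ x))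
      (law ref c φ (θ + s • v))) := by simp [h.integrableExpSet_inner]
  have h1 := (analyticAt_cgf hm).differentiableAt.hasDerivAt
  rw [deriv_cgf_zero hm, probReal_univ, div_one, ← sub_self s] at h1
  have h2 := (HasDerivAt.comp_sub_const s s h1).const_add (logPartition ref c φ (θ + s • v))
  refine h2.congr_of_eventuallyEq (Filter.Eventually.of_forall fun r => ?_)
  simp only
  rw [← h.logPartition_line]
  congr 1
  module

lemma hasDerivAt_integral_inner_line (h : BoundedFamily ref c φ R) (θ v : Par d) (s : ℝ) :
    HasDerivAt (fun s => ∫ x, inner ℝ v (φ x) ∂law ref c φ (θ + s • v))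
      Var[fun x => inner ℝ v (φ x); law ref c φ (θ + s • v)] s := by
  have := h.isProbabilityMeasure_law (θ + s • v)
  have hm : ∀ r : ℝ, r ∈ interior (integrableExpSet (fun x => inner ℝ v (φ x))
      (law ref c φ (θ + s • v))) := by simp [h.integrableExpSet_inner]
  set X : 𝒳 → ℝ := fun x => inner ℝ v (φ x) with hX
  -- Away from its origin the same rebased function has as derivative the mean at the shifted
  -- parameter, so differentiating that mean gives a second cumulant.
  have hd : ∀ r, deriv (cgf X (law ref c φ (θ + s • v))) (r - s) =
      ∫ x, X x ∂law ref c φ (θ + r • v) := by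
    intro r
    have h1 := (analyticAt_cgf (hm (r - s))).differentiableAt.hasDerivAt
    have h2 := (HasDerivAt.comp_sub_const r s h1).const_add (logPartition ref c φ (θ + s • v))
    refine (h2.congr_of_eventuallyEq (Filter.Eventually.of_forall fun r => ?_)).unique
      (h.hasDerivAt_logPartition_line θ v r)
    simp only
    rw [← h.logPartition_line]
    congr 1
    module
  have h3 := (analyticAt_cgf (hm 0)).deriv.differentiableAt.hasDerivAt
  have h4 : deriv (deriv (cgf X (law ref c φ (θ + s • v)))) 0 =
      Var[X; law ref c φ (θ + s • v)] := by
    have h5 := iteratedDeriv_two_cgf_eq_integral (hm 0)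
    rw [iteratedDeriv_succ, iteratedDeriv_one, deriv_cgf_zero (hm 0)] at h5
    rw [h5, variance_eq_integral (h.measurable_inner v).aemeasurable]
    simp [hX]
  rw [h4, ← sub_self s] at h3
  exact (HasDerivAt.comp_sub_const s s h3).congr_of_eventuallyEq
    (Filter.Eventually.of_forall fun r => (hd r).symm)

/-! ### The covariance matrix and its smallest eigenvalue -/

lemma memLp_coord (h : BoundedFamily ref c φ R) (θ : Par d) (j : Fin d) :
    MemLp (fun x => φ x j) 2 (law ref c φ θ) := by
  have := h.isProbabilityMeasure_law θ
  refine MemLp.of_bound (C := R) ?_ (ae_of_all _ fun x => ?_)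
  · have := h.meas_stat
    exact Measurable.aestronglyMeasurable (by fun_prop)
  · exact (PiLp.norm_apply_le (φ x) j).trans (h.norm_le x)

lemma variance_inner_eq (h : BoundedFamily ref c φ R) (θ v : Par d) :
    Var[fun x => inner ℝ v (φ x); law ref c φ θ] =
      v.ofLp ⬝ᵥ (covMatrix ref c φ θ).mulVec v.ofLp := by
  have := h.isProbabilityMeasure_law θ
  rw [← covariance_self (h.measurable_inner v).aemeasurable]
  have h1 : (fun x => inner ℝ v (φ x)) = fun x => ∑ j, v j * φ x j := by
    funext x
    simp [PiLp.inner_apply, mul_comm]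
  rw [h1, covariance_fun_sum_fun_sum (fun j => (h.memLp_coord θ j).const_mul _)
    (fun j => (h.memLp_coord θ j).const_mul _)]
  simp only [covariance_const_mul_left, covariance_const_mul_right, dotProduct, Matrix.mulVec,
    covMatrix, Matrix.of_apply, Finset.mul_sum]
  refine Finset.sum_congr rfl fun i _ => Finset.sum_congr rfl fun j _ => by ring

lemma posSemidef_covMatrix (h : BoundedFamily ref c φ R) (θ : Par d) :
    (covMatrix ref c φ θ).PosSemidef := by
  refine Matrix.PosSemidef.of_dotProduct_mulVec_nonneg ?_ fun v => ?_
  · ext i j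
    simp [covMatrix, covariance_comm]
  · have := h.variance_inner_eq θ (WithLp.toLp 2 v)
    simp only [star_trivial]
    rw [← this]
    exact variance_nonneg _ _

end BoundedFamily

lemma _root_.Matrix.PosSemidef.smallestEigenvalue_nonneg {d : ℕ} {M : Matrix (Fin d) (Fin d) ℝ}
    (hM : M.PosSemidef) : 0 ≤ smallestEigenvalue M :=
  Real.sInf_nonneg (Matrix.posSemidef_iff_isHermitian_and_spectrum_nonneg.1 hM).2

/-- Subtracting the least spectral value times the identity shifts the spectrum into `[0, ∞)`. -/
lemma _root_.Matrix.PosSemidef.smallestEigenvalue_mul_le {d : ℕ} {M : Matrix (Fin d) (Fin d) ℝ}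
    (hM : M.PosSemidef) (v : Par d) :
    smallestEigenvalue M * ‖v‖ ^ 2 ≤ v.ofLp ⬝ᵥ M.mulVec v.ofLp := by
  have hs := (Matrix.posSemidef_iff_isHermitian_and_spectrum_nonneg.1 hM).2
  have h1 : (M - algebraMap ℝ _ (smallestEigenvalue M)).PosSemidef := by
    refine Matrix.posSemidef_iff_isHermitian_and_spectrum_nonneg.2 ⟨?_, fun a ha => ?_⟩
    · refine hM.1.sub ?_
      rw [Matrix.algebraMap_eq_diagonal]
      exact Matrix.isHermitian_diagonal _
    · rw [sub_eq_add_neg, ← map_neg, ← spectrum.add_singleton_eq] at ha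
      obtain ⟨b, hb, e, he, rfl⟩ := Set.mem_add.1 ha
      rw [Set.mem_singleton_iff.1 he]
      have : smallestEigenvalue M ≤ b := csInf_le ⟨0, hs⟩ hb
      simp only [Set.mem_ofPred_eq]
      linarith
  have h2 := h1.dotProduct_mulVec_nonneg v.ofLp
  rw [star_trivial, Matrix.sub_mulVec, dotProduct_sub, Algebra.algebraMap_eq_smul_one,
    Matrix.smul_mulVec, Matrix.one_mulVec, dotProduct_smul] at h2
  have h3 : ‖v‖ ^ 2 = v.ofLp ⬝ᵥ v.ofLp := by
    rw [EuclideanSpace.real_norm_sq_eq]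
    simp [dotProduct, sq]
  rw [h3]
  simpa using h2

/-! ### Strong convexity of `Λ` and the likelihood gradient. -/

namespace BoundedFamily

variable {𝒳 : Type*} [MeasurableSpace 𝒳] {d : ℕ} {ref : Measure 𝒳} {c : 𝒳 → ℝ}
  {φ : 𝒳 → Par d} {R : ℝ}

lemma lam_mul_le_variance (h : BoundedFamily ref c φ R) {Θ : Set (Par d)} {θ : Par d}
    (hθ : θ ∈ Θ) (v : Par d) :
    lam ref c φ Θ * ‖v‖ ^ 2 ≤ Var[fun x => inner ℝ v (φ x); law ref c φ θ] := by
  rw [h.variance_inner_eq]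
  refine le_trans (mul_le_mul_of_nonneg_right ?_ (sq_nonneg _))
    ((h.posSemidef_covMatrix θ).smallestEigenvalue_mul_le v)
  refine csInf_le ⟨0, ?_⟩ (Set.mem_image_of_mem _ hθ)
  rintro _ ⟨θ', -, rfl⟩
  exact (h.posSemidef_covMatrix θ').smallestEigenvalue_nonneg

/-- By the mean value theorem the increment is a variance at an intermediate parameter, which
convexity keeps in `Θ`. -/
lemma lam_mul_le_integral_sub (h : BoundedFamily ref c φ R) {Θ : Set (Par d)}
    (hΘ : Convex ℝ Θ) {θ θ' : Par d} (hθ : θ ∈ Θ) (hθ' : θ' ∈ Θ) :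
    lam ref c φ Θ * ‖θ' - θ‖ ^ 2 ≤ ∫ x, inner ℝ (θ' - θ) (φ x) ∂law ref c φ θ'
      - ∫ x, inner ℝ (θ' - θ) (φ x) ∂law ref c φ θ := by
  have hd := h.hasDerivAt_integral_inner_line θ (θ' - θ)
  obtain ⟨s, hs, he⟩ := exists_hasDerivAt_eq_slope _ _ zero_lt_one
    (fun s _ => (hd s).continuousAt.continuousWithinAt) (fun s _ => hd s)
  simp only [one_smul, zero_smul, add_zero, add_sub_cancel, sub_zero, div_one] at he
  rw [← he]
  exact h.lam_mul_le_variance (hΘ.add_smul_sub_mem hθ hθ' ⟨hs.1.le, hs.2.le⟩) _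

/-- First-order optimality of the maximum likelihood estimate. -/
lemma inner_mean_le_of_isMLE (h : BoundedFamily ref c φ R) {Θ : Set (Par d)}
    (hΘ : Convex ℝ Θ) {n : ℕ} {x : Fin n → 𝒳} (hx : ∀ i, 0 < c (x i)) {θhat θ : Par d}
    (hm : IsMLE ref c φ Θ x θhat) (hθ : θ ∈ Θ) :
    ∑ i, inner ℝ (θ - θhat) (φ (x i)) ≤
      n * ∫ y, inner ℝ (θ - θhat) (φ y) ∂law ref c φ θhat := by
  set v := θ - θhat with hv
  set S := ∑ i, inner ℝ v (φ (x i)) with hS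
  -- The maximizer may lie on the boundary of `Θ`, so only the segment towards `θ` is compared and
  -- only the right derivative at `0` is used.
  have key : ∀ s ∈ Set.Icc (0 : ℝ) 1, s * S ≤
      n * (logPartition ref c φ (θhat + s • v) - logPartition ref c φ θhat) := by
    intro s hs
    have h1 : ∏ i, density ref c φ (θhat + s • v) (x i) ≤ ∏ i, density ref c φ θhat (x i) :=
      hm.2 (hΘ.add_smul_sub_mem hm.1 hθ hs)
    simp only [density, Finset.prod_mul_distrib, ← Real.exp_sum] at h1
    rw [mul_le_mul_iff_right₀ (Finset.prod_pos fun i _ => hx i), Real.exp_le_exp] at h1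
    simp only [Finset.sum_sub_distrib, inner_add_left, real_inner_smul_left,
      Finset.sum_add_distrib, ← Finset.mul_sum, Finset.sum_const, Finset.card_univ,
      Fintype.card_fin, nsmul_eq_mul] at h1
    rw [← hS] at h1
    linarith
  have hd := (h.hasDerivAt_logPartition_line θhat v 0).const_mul (n : ℝ)
  rw [zero_smul, add_zero] at hd
  have ht := hd.tendsto_slope_zero_right
  refine ge_of_tendsto ht ?_
  filter_upwards [Ioc_mem_nhdsGT zero_lt_one] with s hs
  have := key s ⟨hs.1.le, hs.2⟩
  simp only [zero_add, zero_smul, add_zero, smul_eq_mul]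
  rw [inv_mul_eq_div, le_div_iff₀ hs.1]
  linarith

/-- The exact likelihood gradient points towards the maximum likelihood estimate. -/
lemma inner_likelihood_gradient_le (h : BoundedFamily ref c φ R) {Θ : Set (Par d)}
    (hΘ : Convex ℝ Θ) {n : ℕ} {x : Fin n → 𝒳} (hx : ∀ i, 0 < c (x i)) (hn : 0 < n)
    {θhat θ : Par d} (hm : IsMLE ref c φ Θ x θhat) (hθ : θ ∈ Θ) :
    1 / (n : ℝ) * ∑ i, inner ℝ (θ - θhat) (φ (x i))
      - ∫ y, inner ℝ (θ - θhat) (φ y) ∂law ref c φ θ ≤ -(lam ref c φ Θ * ‖θ - θhat‖ ^ 2) := by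
  have h1 := h.inner_mean_le_of_isMLE hΘ hx hm hθ
  have h2 := h.lam_mul_le_integral_sub hΘ hm.1 hθ
  have hn' : (0 : ℝ) < n := Nat.cast_pos.2 hn
  rw [← div_le_iff₀' hn', ← one_div_mul_eq_div] at h1
  linarith

end BoundedFamily

/-! ### Inequalities in `L²`. -/

section SecondMoments

variable {α : Type*} [MeasurableSpace α] {μ : Measure α}

/-- The Cauchy-Schwarz inequality. -/
lemma integral_mul_le_sqrt_mul_sqrt {f g : α → ℝ} (hf : MemLp f 2 μ) (hg : MemLp g 2 μ) :
    ∫ x, f x * g x ∂μ ≤ √(∫ x, f x ^ 2 ∂μ) * √(∫ x, g x ^ 2 ∂μ) := by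
  -- The quadratic `s ↦ ∫ (s f + g)²` is nonnegative.
  have hd := discrim_le_zero (a := ∫ x, f x ^ 2 ∂μ) (b := 2 * ∫ x, f x * g x ∂μ)
    (c := ∫ x, g x ^ 2 ∂μ) fun s => by
      have hfg : Integrable (fun x => f x * g x) μ := hf.integrable_mul hg
      calc 0 ≤ ∫ x, (s * f x + g x) ^ 2 ∂μ := integral_nonneg fun x => sq_nonneg _
        _ = ∫ x, (s * s * f x ^ 2 + 2 * s * (f x * g x)) + g x ^ 2 ∂μ := by
          congr 1; funext x; ring
        _ = _ := by
          have hi : Integrable (fun x => s * s * f x ^ 2 + 2 * s * (f x * g x)) μ :=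
            (hf.integrable_sq.const_mul _).add (hfg.const_mul _)
          rw [integral_add hi hg.integrable_sq,
            integral_add (hf.integrable_sq.const_mul _) (hfg.const_mul _),
            integral_const_mul, integral_const_mul]
          ring
  rw [← Real.sqrt_mul (integral_nonneg fun x => sq_nonneg _)]
  apply Real.le_sqrt_of_sq_le
  rw [discrim] at hd
  linarith

lemma sqrt_integral_sq_le_add [IsProbabilityMeasure μ] {f g : α → ℝ} (hf : MemLp f 2 μ)
    (hg : MemLp g 2 μ) {D : ℝ} (h : ∀ x, |f x - g x| ≤ D) :
    √(∫ x, f x ^ 2 ∂μ) ≤ √(∫ x, g x ^ 2 ∂μ) + D := by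
  obtain ⟨x₀⟩ : Nonempty α := nonempty_of_isProbabilityMeasure μ
  have hD : 0 ≤ D := (abs_nonneg _).trans (h x₀)
  have hg1 : Integrable g μ := hg.integrable one_le_two
  have h1 : ∫ x, |g x| ∂μ ≤ √(∫ x, g x ^ 2 ∂μ) := by
    simpa using integral_mul_le_sqrt_mul_sqrt hg.abs (memLp_const (1 : ℝ))
  refine Real.sqrt_le_iff.2 ⟨by positivity, ?_⟩
  calc ∫ x, f x ^ 2 ∂μ ≤ ∫ x, (g x ^ 2 + 2 * D * |g x|) + D ^ 2 ∂μ := by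
        refine integral_mono hf.integrable_sq
          ((hg.integrable_sq.add (hg1.abs.const_mul _)).add (integrable_const _)) fun x => ?_
        have h2 : |f x| ≤ |g x| + D := by
          have := abs_sub_abs_le_abs_sub (f x) (g x)
          linarith [h x]
        calc f x ^ 2 = |f x| ^ 2 := (sq_abs _).symm
          _ ≤ (|g x| + D) ^ 2 := by gcongr
          _ = g x ^ 2 + 2 * D * |g x| + D ^ 2 := by rw [← sq_abs (g x)]; ring
    _ = ∫ x, g x ^ 2 ∂μ + 2 * D * ∫ x, |g x| ∂μ + D ^ 2 := by
        have hi : Integrable (fun x => g x ^ 2 + 2 * D * |g x|) μ :=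
          hg.integrable_sq.add (hg1.abs.const_mul _)
        rw [integral_add hi (integrable_const _),
          integral_add hg.integrable_sq (hg1.abs.const_mul _), integral_const_mul]
        simp
    _ ≤ √(∫ x, g x ^ 2 ∂μ) ^ 2 + 2 * D * √(∫ x, g x ^ 2 ∂μ) + D ^ 2 := by
        rw [Real.sq_sqrt (integral_nonneg fun x => sq_nonneg _)]
        gcongr
    _ = _ := by ring

lemma abs_sqrt_integral_sq_sub_le [IsProbabilityMeasure μ] {f g : α → ℝ} (hf : MemLp f 2 μ)
    (hg : MemLp g 2 μ) {D : ℝ} (h : ∀ x, |f x - g x| ≤ D) :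
    |√(∫ x, f x ^ 2 ∂μ) - √(∫ x, g x ^ 2 ∂μ)| ≤ D := by
  rw [abs_sub_le_iff]
  constructor
  · linarith [sqrt_integral_sq_le_add hf hg h]
  · linarith [sqrt_integral_sq_le_add hg hf fun x => abs_sub_comm (f x) (g x) ▸ h x]

end SecondMoments

/-! ### The χ-distance through the logarithmic likelihood ratio. -/

lemma abs_two_mul_sinh_half_sub_le {M a b : ℝ} (ha : |a| ≤ M) (hb : |b| ≤ M) :
    |2 * Real.sinh (a / 2) - 2 * Real.sinh (b / 2)| ≤ Real.cosh (M / 2) * |a - b| := by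
  have hd : ∀ s : ℝ, HasDerivAt (fun s => 2 * Real.sinh (s / 2)) (Real.cosh (s / 2)) s := by
    intro s
    have := (((hasDerivAt_id s).div_const 2).sinh).const_mul 2
    simpa [mul_comm, mul_assoc] using this
  refine (convex_Icc (-M) M).norm_image_sub_le_of_norm_hasDerivWithin_le
    (fun s _ => (hd s).hasDerivWithinAt) (fun s hs => ?_) (abs_le.1 hb) (abs_le.1 ha)
  rw [Real.norm_of_nonneg (Real.cosh_pos _).le, Real.cosh_le_cosh, abs_div, abs_div]
  refine div_le_div_of_nonneg_right ?_ (abs_nonneg _)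
  exact (abs_le.2 hs).trans (le_abs_self M)

/-- For `u = log (p_{θ*} / p_θ)`, integration under `p_{θ*}` sends `exp (-u)` to `1` and `exp u` to
the exponential in `chiFun`. -/
lemma two_mul_sinh_half_sq (u : ℝ) :
    (2 * Real.sinh (u / 2)) ^ 2 = Real.exp u + Real.exp (-u) - 2 := by
  have h : Real.exp (u / 2) * Real.exp (-(u / 2)) = 1 := by rw [← Real.exp_add]; simp
  have h1 : Real.exp u = Real.exp (u / 2) ^ 2 := by rw [← Real.exp_nat_mul]; ring_nf
  have h2 : Real.exp (-u) = Real.exp (-(u / 2)) ^ 2 := by rw [← Real.exp_nat_mul]; ring_nf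
  rw [Real.sinh_eq, h1, h2]
  linear_combination (-2) * h

/-- The logarithm of the likelihood ratio `p_{θ*} / p_θ`. -/
noncomputable def logRatio {𝒳 : Type*} [MeasurableSpace 𝒳] {d : ℕ} (ref : Measure 𝒳) (c : 𝒳 → ℝ)
    (φ : 𝒳 → Par d) (θstar θ : Par d) (x : 𝒳) : ℝ :=
  inner ℝ (θstar - θ) (φ x) - logPartition ref c φ θstar + logPartition ref c φ θ

namespace BoundedFamily

variable {𝒳 : Type*} [MeasurableSpace 𝒳] {d : ℕ} {ref : Measure 𝒳} {c : 𝒳 → ℝ}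
  {φ : 𝒳 → Par d} {R : ℝ}

lemma measurable_logRatio (h : BoundedFamily ref c φ R) (θstar θ : Par d) :
    Measurable (logRatio ref c φ θstar θ) :=
  ((h.measurable_inner _).sub_const _).add_const _

lemma abs_logRatio_sub_le (h : BoundedFamily ref c φ R) (θstar θ θ' : Par d) (x : 𝒳) :
    |logRatio ref c φ θstar θ x - logRatio ref c φ θstar θ' x| ≤ 2 * R * ‖θ - θ'‖ := by
  have h1 := h.abs_logPartition_sub_le θ θ'
  have h2 := h.abs_inner_le (θ' - θ) x
  rw [norm_sub_rev θ' θ] at h2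
  have h3 : logRatio ref c φ θstar θ x - logRatio ref c φ θstar θ' x =
      inner ℝ (θ' - θ) (φ x) + (logPartition ref c φ θ - logPartition ref c φ θ') := by
    simp only [logRatio, inner_sub_left]; ring
  rw [h3]
  refine (abs_add_le _ _).trans ?_
  linarith

lemma abs_logRatio_le (h : BoundedFamily ref c φ R) (θstar θ : Par d) (x : 𝒳) :
    |logRatio ref c φ θstar θ x| ≤ 2 * R * ‖θ - θstar‖ := by
  have := h.abs_logRatio_sub_le θstar θ θstar x
  simpa [logRatio] using this

lemma integral_law_eq_exp_logRatio (h : BoundedFamily ref c φ R) (θstar θ : Par d) (g : 𝒳 → ℝ) :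
    ∫ x, g x ∂law ref c φ θ =
      ∫ x, Real.exp (-logRatio ref c φ θstar θ x) * g x ∂law ref c φ θstar := by
  rw [h.integral_law_change θstar θ]
  congr 1; funext x
  congr 2
  simp only [logRatio, inner_sub_left]; ring

lemma memLp_of_bound (h : BoundedFamily ref c φ R) (θ : Par d) {g : 𝒳 → ℝ}
    (hg : Measurable g) {B : ℝ} (hB : ∀ x, |g x| ≤ B) : MemLp g 2 (law ref c φ θ) :=
  have := h.isProbabilityMeasure_law θ
  MemLp.of_bound hg.aestronglyMeasurable B (ae_of_all _ hB)

lemma measurable_sinh_logRatio (h : BoundedFamily ref c φ R) (θstar θ : Par d) :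
    Measurable fun x => 2 * Real.sinh (logRatio ref c φ θstar θ x / 2) :=
  (Real.measurable_sinh.comp ((h.measurable_logRatio θstar θ).div_const 2)).const_mul 2

lemma memLp_sinh_logRatio (h : BoundedFamily ref c φ R) (θstar θ : Par d) :
    MemLp (fun x => 2 * Real.sinh (logRatio ref c φ θstar θ x / 2)) 2 (law ref c φ θstar) := by
  refine h.memLp_of_bound _ (h.measurable_sinh_logRatio θstar θ)
    (B := Real.cosh (2 * R * ‖θ - θstar‖ / 2) * (2 * R * ‖θ - θstar‖)) fun x => ?_
  have hb := h.abs_logRatio_le θstar θ x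
  have := abs_two_mul_sinh_half_sub_le hb (b := 0) (by simpa using (abs_nonneg _).trans hb)
  simp only [zero_div, Real.sinh_zero, mul_zero, sub_zero] at this
  exact this.trans (mul_le_mul_of_nonneg_left hb (Real.cosh_pos _).le)

/-- The χ-distance becomes an `L²`-norm under a law independent of `θ`, so its Lipschitz bound
follows from a pointwise one by the reverse triangle inequality. -/
lemma chiFun_eq (h : BoundedFamily ref c φ R) (θstar θ : Par d) :
    chiFun ref c φ θstar θ =
      √(∫ x, (2 * Real.sinh (logRatio ref c φ θstar θ x / 2)) ^ 2 ∂law ref c φ θstar) := by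
  have hp := h.isProbabilityMeasure_law θstar
  have hp' := h.isProbabilityMeasure_law θ
  have hi : ∀ e : ℝ, |e| = 1 →
      Integrable (fun x => Real.exp (e * logRatio ref c φ θstar θ x)) (law ref c φ θstar) := by
    intro e he
    refine h.integrable_of_bound θstar ((h.measurable_logRatio θstar θ).const_mul e).exp
      (B := Real.exp (2 * R * ‖θ - θstar‖)) fun x => ?_
    rw [abs_of_pos (Real.exp_pos _)]
    refine Real.exp_le_exp.2 ((le_abs_self _).trans ?_)
    rw [abs_mul, he, one_mul]
    exact h.abs_logRatio_le θstar θ x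
  have hi1 := hi 1 (by simp)
  have hi2 := hi (-1) (by simp)
  simp only [one_mul, neg_one_mul] at hi1 hi2
  rw [chiFun]
  congr 1
  simp_rw [two_mul_sinh_half_sq]
  have hi3 : Integrable (fun x => Real.exp (logRatio ref c φ θstar θ x)
      + Real.exp (-logRatio ref c φ θstar θ x)) (law ref c φ θstar) := hi1.add hi2
  rw [integral_sub hi3 (integrable_const _), integral_add hi1 hi2]
  have h1 : ∫ x, Real.exp (-logRatio ref c φ θstar θ x) ∂law ref c φ θstar = 1 := by
    have := h.integral_law_eq_exp_logRatio θstar θ fun _ => 1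
    simpa using this.symm
  have h2 : ∫ x, Real.exp (logRatio ref c φ θstar θ x) ∂law ref c φ θstar =
      Real.exp (-2 * logPartition ref c φ θstar + logPartition ref c φ θ
        + logPartition ref c φ ((2 : ℝ) • θstar - θ)) := by
    have h3 := h.exp_logPartition_sub θstar ((2 : ℝ) • θstar - θ)
    rw [show (2 : ℝ) • θstar - θ - θstar = θstar - θ by module] at h3
    have h4 : ∀ x, Real.exp (logRatio ref c φ θstar θ x) =
        Real.exp (inner ℝ (θstar - θ) (φ x)) *
          Real.exp (-logPartition ref c φ θstar + logPartition ref c φ θ) := fun x => by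
      rw [← Real.exp_add, logRatio]; ring_nf
    simp_rw [h4, integral_mul_const, ← h3, ← Real.exp_add]
    ring_nf
  rw [h1, h2]
  simp only [integral_const, probReal_univ, one_smul]
  ring

lemma abs_chiFun_sub_le (h : BoundedFamily ref c φ R) {θstar θ θ' : Par d} {D : ℝ}
    (hR : 0 ≤ R) (hθ : ‖θ - θstar‖ ≤ D) (hθ' : ‖θ' - θstar‖ ≤ D) :
    |chiFun ref c φ θstar θ - chiFun ref c φ θstar θ'| ≤
      Real.cosh (2 * R * D / 2) * (2 * R) * ‖θ - θ'‖ := by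
  have hp := h.isProbabilityMeasure_law θstar
  rw [h.chiFun_eq, h.chiFun_eq, mul_assoc]
  refine abs_sqrt_integral_sq_sub_le (h.memLp_sinh_logRatio θstar θ)
    (h.memLp_sinh_logRatio θstar θ') fun x => ?_
  refine (abs_two_mul_sinh_half_sub_le (M := 2 * R * D) ?_ ?_).trans
    (mul_le_mul_of_nonneg_left (h.abs_logRatio_sub_le θstar θ θ' x) (Real.cosh_pos _).le)
  · exact (h.abs_logRatio_le θstar θ x).trans (by gcongr)
  · exact (h.abs_logRatio_le θstar θ' x).trans (by gcongr)

lemma nonneg_bound (h : BoundedFamily ref c φ R) : 0 ≤ R := by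
  obtain ⟨θ₀, -, -⟩ := h.exists_base
  have := h.isProbabilityMeasure_law θ₀
  obtain ⟨x₀⟩ := nonempty_of_isProbabilityMeasure (law ref c φ θ₀)
  exact (norm_nonneg _).trans (h.norm_le x₀)

/-- Rules out the default value `0` that the infimum in `lipConst` takes on the empty set. -/
lemma exists_lipschitzOnWith_chiFun (h : BoundedFamily ref c φ R) {Θ : Set (Par d)}
    (hΘ : Bornology.IsBounded Θ) (θstar : Par d) :
    ∃ K, LipschitzOnWith K (chiFun ref c φ θstar) Θ := by
  obtain ⟨D, hD⟩ := hΘ.subset_closedBall θstar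
  have hD' : ∀ θ ∈ Θ, ‖θ - θstar‖ ≤ D := fun θ hθ => by
    simpa [dist_eq_norm] using hD hθ
  refine ⟨_, LipschitzOnWith.of_dist_le_mul
    (K := (Real.cosh (2 * R * D / 2) * (2 * R)).toNNReal) fun θ hθ θ' hθ' => ?_⟩
  rw [Real.dist_eq, dist_eq_norm, Real.coe_toNNReal _
    (mul_nonneg (Real.cosh_pos _).le (mul_nonneg zero_le_two h.nonneg_bound))]
  exact h.abs_chiFun_sub_le h.nonneg_bound (hD' θ hθ) (hD' θ' hθ')

lemma chiFun_le_lipConst_mul (h : BoundedFamily ref c φ R) {Θ : Set (Par d)}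
    (hΘ : Bornology.IsBounded Θ) {θstar θ : Par d} (hθs : θstar ∈ Θ) (hθ : θ ∈ Θ) :
    chiFun ref c φ θstar θ ≤ lipConst ref c φ Θ θstar * ‖θ - θstar‖ := by
  set S := {K : ℝ≥0 | LipschitzOnWith K (chiFun ref c φ θstar) Θ}
  have hS : S.Nonempty := h.exists_lipschitzOnWith_chiFun hΘ θstar
  have hcl : IsClosed {K : ℝ≥0 | chiFun ref c φ θstar θ ≤ K * ‖θ - θstar‖} :=
    isClosed_le continuous_const (by fun_prop)
  -- The inequality is closed in `K`, so it passes to the infimum.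
  refine closure_minimal (fun K hK => ?_) hcl (csInf_mem_closure hS (OrderBot.bddBelow S))
  have h1 := LipschitzOnWith.dist_le_mul hK θ hθ θstar hθs
  have h2 : chiFun ref c φ θstar θstar = 0 := by
    rw [chiFun, two_smul, add_sub_cancel_right]
    ring_nf
    simp
  rw [h2, Real.dist_eq, sub_zero, dist_eq_norm] at h1
  exact (le_abs_self _).trans h1

end BoundedFamily

/-! ### Contraction of Markov operators in `L²`. -/

section MarkovOperator

variable {𝒳 : Type*} [MeasurableSpace 𝒳]

lemma eLpNorm_two_pow_two {μ : Measure 𝒳} (f : 𝒳 → ℝ) :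
    eLpNorm f 2 μ ^ 2 = ∫⁻ x, ‖f x‖ₑ ^ 2 ∂μ := by
  rw [eLpNorm_eq_lintegral_rpow_enorm_toReal two_ne_zero ENNReal.ofNat_ne_top,
    ← ENNReal.rpow_natCast, ← ENNReal.rpow_mul]
  simp

lemma eLpNorm_two_eq_ofReal_sqrt {μ : Measure 𝒳} {f : 𝒳 → ℝ} (hf : MemLp f 2 μ) :
    eLpNorm f 2 μ = ENNReal.ofReal √(∫ x, f x ^ 2 ∂μ) := by
  rw [← ENNReal.pow_right_strictMono two_ne_zero |>.injective.eq_iff, eLpNorm_two_pow_two,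
    ← ENNReal.ofReal_pow (Real.sqrt_nonneg _),
    Real.sq_sqrt (integral_nonneg fun x => sq_nonneg _),
    ofReal_integral_eq_lintegral_ofReal hf.integrable_sq (ae_of_all _ fun x => sq_nonneg _)]
  congr 1; funext x
  rw [← sq_abs, ENNReal.ofReal_pow (abs_nonneg _), ← Real.norm_eq_abs, ofReal_norm]

/-- Markov operators are contractions of `L²` of an invariant law. -/
lemma eLpNorm_markov_sub_le {κ : Kernel 𝒳 𝒳} [IsMarkovKernel κ] {π : Measure 𝒳}
    [IsProbabilityMeasure π] (hκ : κ.Invariant π) {f : 𝒳 → ℝ} (hf : MemLp f 2 π) (a : ℝ) :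
    eLpNorm (fun x => ∫ y, f y ∂(κ x) - a) 2 π ≤ eLpNorm (fun x => f x - a) 2 π := by
  have hg : MemLp (fun x => f x - a) 2 π := hf.sub (memLp_const a)
  rw [← ENNReal.pow_le_pow_left_iff two_ne_zero, eLpNorm_two_pow_two, eLpNorm_two_pow_two]
  have hm : AEMeasurable (fun x => ‖f x - a‖ₑ ^ 2) (π.bind κ) := by
    rw [hκ.def]
    exact hg.1.enorm.pow_const 2
  -- Invariance disintegrates the right side over the laws `κ x`; Jensen's inequality then applies
  -- for almost every `x`.
  conv_rhs => rw [← hκ.def, Measure.lintegral_bind κ.measurable.aemeasurable hm]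
  have hfi : Integrable f (π.bind κ) := by
    rw [hκ.def]
    exact hf.integrable one_le_two
  refine lintegral_mono_ae ?_
  filter_upwards [((Measure.integrable_comp_iff hfi.1).1 hfi).1] with x hx
  have h1 : ∫ y, f y ∂(κ x) - a = ∫ y, (f y - a) ∂(κ x) := by
    rw [integral_sub hx (integrable_const _)]
    simp
  rw [h1, ← eLpNorm_two_pow_two]
  gcongr
  calc ‖∫ y, (f y - a) ∂(κ x)‖ₑ ≤ ∫⁻ y, ‖f y - a‖ₑ ∂(κ x) := enorm_integral_le_lintegral_enorm _
    _ = eLpNorm (fun y => f y - a) 1 (κ x) := by rw [eLpNorm_one_eq_lintegral_enorm]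
    _ ≤ eLpNorm (fun y => f y - a) 2 (κ x) :=
        eLpNorm_le_eLpNorm_of_exponent_le one_le_two (hx.1.sub aestronglyMeasurable_const)

lemma l2Contraction_nonneg (κ : Kernel 𝒳 𝒳) (π : Measure 𝒳) : 0 ≤ l2Contraction κ π :=
  Real.sInf_nonneg fun _ h => h.1

/-- The infimum that defines the norm of the Markov operator is attained. -/
lemma eLpNorm_markov_sub_le_l2Contraction {κ : Kernel 𝒳 𝒳} [IsMarkovKernel κ] {π : Measure 𝒳}
    [IsProbabilityMeasure π] (hκ : κ.Invariant π) {f : 𝒳 → ℝ} (hf : MemLp f 2 π) :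
    eLpNorm (fun x => ∫ y, f y ∂(κ x) - ∫ y, f y ∂π) 2 π ≤
      ENNReal.ofReal (l2Contraction κ π) * eLpNorm (fun x => f x - ∫ y, f y ∂π) 2 π := by
  set S := {a : ℝ | 0 ≤ a ∧ ∀ f : 𝒳 → ℝ, MemLp f 2 π →
    eLpNorm (fun x => ∫ y, f y ∂(κ x) - ∫ y, f y ∂π) 2 π ≤
      ENNReal.ofReal a * eLpNorm (fun x => f x - ∫ y, f y ∂π) 2 π}
  have hS : S.Nonempty := ⟨1, zero_le_one, fun f hf => by
    simpa using eLpNorm_markov_sub_le hκ hf (∫ y, f y ∂π)⟩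
  have hfin : eLpNorm (fun x => f x - ∫ y, f y ∂π) 2 π ≠ ∞ :=
    (hf.sub (memLp_const (∫ y, f y ∂π))).eLpNorm_ne_top
  have hcl : IsClosed {a : ℝ | eLpNorm (fun x => ∫ y, f y ∂(κ x) - ∫ y, f y ∂π) 2 π ≤
      ENNReal.ofReal a * eLpNorm (fun x => f x - ∫ y, f y ∂π) 2 π} :=
    isClosed_le continuous_const
      ((ENNReal.continuous_mul_const hfin).comp ENNReal.continuous_ofReal)
  exact closure_minimal (fun a ha => ha.2 f hf) hcl
    (csInf_mem_closure hS ⟨0, fun _ h => h.1⟩)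

lemma isMarkovKernel_pow (κ : Kernel 𝒳 𝒳) [IsMarkovKernel κ] (m : ℕ) :
    IsMarkovKernel (κ ^ m) := by
  induction m with
  | zero => exact inferInstanceAs (IsMarkovKernel Kernel.id)
  | succ m ih =>
    rw [pow_succ]
    exact inferInstanceAs (IsMarkovKernel ((κ ^ m) ∘ₖ κ))

lemma invariant_pow {κ : Kernel 𝒳 𝒳} {π : Measure 𝒳} (hκ : κ.Invariant π) (m : ℕ) :
    (κ ^ m).Invariant π := by
  induction m with
  | zero =>
    change π.bind (Kernel.id : Kernel 𝒳 𝒳) = π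
    simp
  | succ m ih =>
    rw [pow_succ]
    exact ih.comp hκ

lemma measurable_integral_kernel (κ : Kernel 𝒳 𝒳) {f : 𝒳 → ℝ} (hf : Measurable f) :
    Measurable fun x => ∫ y, f y ∂(κ x) :=
  (hf.stronglyMeasurable.integral_kernel (κ := κ)).measurable

lemma abs_integral_le_of_bound {μ : Measure 𝒳} [IsProbabilityMeasure μ] {f : 𝒳 → ℝ} {B : ℝ}
    (hB : ∀ x, |f x| ≤ B) : |∫ y, f y ∂μ| ≤ B := by
  simpa using norm_integral_le_of_norm_le_const (μ := μ) (f := f) (ae_of_all _ hB)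

lemma integrable_of_abs_le {μ : Measure 𝒳} [IsFiniteMeasure μ] {f : 𝒳 → ℝ} (hf : Measurable f)
    {B : ℝ} (hB : ∀ x, |f x| ≤ B) : Integrable f μ :=
  Integrable.of_bound hf.aestronglyMeasurable B (ae_of_all _ hB)

lemma memLp_two_of_abs_le {μ : Measure 𝒳} [IsFiniteMeasure μ] {f : 𝒳 → ℝ} (hf : Measurable f)
    {B : ℝ} (hB : ∀ x, |f x| ≤ B) : MemLp f 2 μ :=
  MemLp.of_bound hf.aestronglyMeasurable B (ae_of_all _ hB)

lemma integral_bind_kernel {μ : Measure 𝒳} {κ : Kernel 𝒳 𝒳} {f : 𝒳 → ℝ}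
    (hf : Integrable f (μ.bind κ)) :
    ∫ y, f y ∂(μ.bind κ) = ∫ x, ∫ y, f y ∂(κ x) ∂μ := by
  rw [Measure.comp_eq_comp_const_apply] at hf ⊢
  rw [Kernel.integral_comp hf, Kernel.const_apply]

/-- Geometric decay of the iterates of a Markov operator with a spectral gap. -/
lemma sqrt_integral_markov_pow_sub_sq_le {κ : Kernel 𝒳 𝒳} [IsMarkovKernel κ] {π : Measure 𝒳}
    [IsProbabilityMeasure π] (hκ : κ.Invariant π) {f : 𝒳 → ℝ} (hf : Measurable f) {B : ℝ}
    (hB : ∀ x, |f x| ≤ B) (m : ℕ) :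
    √(∫ x, (∫ y, f y ∂((κ ^ m) x) - ∫ y, f y ∂π) ^ 2 ∂π) ≤
      l2Contraction κ π ^ m * √(∫ x, (f x - ∫ y, f y ∂π) ^ 2 ∂π) := by
  have hl := l2Contraction_nonneg κ π
  induction m with
  | zero =>
    have h : ∀ x, ∫ y, f y ∂((κ ^ 0) x) = f x := fun x => by
      change ∫ y, f y ∂((Kernel.id : Kernel 𝒳 𝒳) x) = f x
      rw [Kernel.id_apply, integral_dirac' _ _ hf.stronglyMeasurable]
    simp_rw [h, pow_zero, one_mul]
    exact le_rfl
  | succ m ih =>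
    have := isMarkovKernel_pow κ m
    -- Invariance gives `g` the same `π`-mean as `f`, so the one-step contraction applies to it.
    set g : 𝒳 → ℝ := fun x => ∫ y, f y ∂((κ ^ m) x) with hg
    have hgm : Measurable g := measurable_integral_kernel _ hf
    have hgB : ∀ x, |g x| ≤ B := fun x => abs_integral_le_of_bound hB
    have hgi : ∫ y, g y ∂π = ∫ y, f y ∂π := by
      have hm := invariant_pow hκ m
      have hi : Integrable f (π.bind (κ ^ m : Kernel 𝒳 𝒳)) := by
        rw [hm.def]
        exact integrable_of_abs_le hf hB
      have h1 := integral_bind_kernel hi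
      rw [hm.def] at h1
      exact h1.symm
    have hstep : ∀ x, ∫ y, f y ∂((κ ^ (m + 1)) x) = ∫ y, g y ∂(κ x) := fun x => by
      rw [pow_succ]
      change ∫ y, f y ∂(((κ ^ m) ∘ₖ κ) x) = _
      exact Kernel.integral_comp (integrable_of_abs_le hf hB)
    have hκg : Measurable fun x => ∫ y, g y ∂(κ x) := measurable_integral_kernel _ hgm
    have h2 := eLpNorm_markov_sub_le_l2Contraction hκ (memLp_two_of_abs_le (μ := π) hgm hgB)
    rw [eLpNorm_two_eq_ofReal_sqrt, eLpNorm_two_eq_ofReal_sqrt, ← ENNReal.ofReal_mul hl,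
      ENNReal.ofReal_le_ofReal_iff (by positivity), hgi] at h2
    · simp_rw [hstep]
      refine h2.trans ?_
      rw [pow_succ', mul_assoc]
      exact mul_le_mul_of_nonneg_left ih hl
    · exact (memLp_two_of_abs_le hgm hgB).sub (memLp_const _)
    · exact (memLp_two_of_abs_le hκg fun x => abs_integral_le_of_bound hgB).sub (memLp_const _)

end MarkovOperator

/-! ### Bias of the chain started at the true law. -/

namespace BoundedFamily

variable {𝒳 : Type*} [MeasurableSpace 𝒳] {d : ℕ} {ref : Measure 𝒳} {c : 𝒳 → ℝ}
  {φ : 𝒳 → Par d} {R : ℝ}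

/-- The expectations of `g` under two laws of the family differ by at most the `L²`-norm of `g`
times the `χ`-distance. -/
lemma integral_law_sub_le (h : BoundedFamily ref c φ R) (θstar θ : Par d) {g : 𝒳 → ℝ}
    (hg : Measurable g) {B : ℝ} (hB : ∀ x, |g x| ≤ B) :
    ∫ x, g x ∂law ref c φ θ - ∫ x, g x ∂law ref c φ θstar ≤
      √(∫ x, g x ^ 2 ∂law ref c φ θ) * chiFun ref c φ θstar θ := by
  have hp := h.isProbabilityMeasure_law θstar
  set u := logRatio ref c φ θstar θ with hu
  have hum : Measurable u := h.measurable_logRatio θstar θ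
  have hub := h.abs_logRatio_le θstar θ
  set M := 2 * R * ‖θ - θstar‖
  have hexp : ∀ (x : 𝒳) (e : ℝ), 0 ≤ e → e ≤ 1 → |Real.exp (-(e * u x))| ≤ Real.exp M := by
    intro x e he0 he1
    rw [abs_of_pos (Real.exp_pos _)]
    refine Real.exp_le_exp.2 ((neg_le_abs _).trans ?_)
    rw [abs_mul, abs_of_nonneg he0]
    exact (mul_le_of_le_one_left (abs_nonneg _) he1).trans (hub x)
  have hB0 : ∀ x, |g x| ≤ |B| := fun x => (hB x).trans (le_abs_self B)
  have hw : MemLp (fun x => Real.exp (-(1 / 2 * u x)) * g x) 2 (law ref c φ θstar) := by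
    refine memLp_two_of_abs_le (((hum.const_mul _).neg.exp).mul hg) (B := Real.exp M * |B|)
      fun x => ?_
    rw [abs_mul]
    exact mul_le_mul (hexp x _ (by norm_num) (by norm_num)) (hB0 x) (abs_nonneg _)
      (Real.exp_pos _).le
  have hi : Integrable (fun x => Real.exp (-u x) * g x) (law ref c φ θstar) := by
    refine integrable_of_abs_le (hum.neg.exp.mul hg) (B := Real.exp M * |B|) fun x => ?_
    rw [abs_mul]
    exact mul_le_mul (by simpa using hexp x 1 zero_le_one le_rfl) (hB0 x) (abs_nonneg _)
      (Real.exp_pos _).le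
  rw [h.integral_law_eq_exp_logRatio θstar θ g, ← integral_sub hi (integrable_of_abs_le hg hB),
    h.integral_law_eq_exp_logRatio θstar θ fun x => g x ^ 2, h.chiFun_eq]
  have hcs := integral_mul_le_sqrt_mul_sqrt hw (h.memLp_sinh_logRatio θstar θ).neg
  -- Here `exp (-u)` is the density of `p_θ` against `p_{θ*}`. Splitting off `exp (-u/2)` leaves the
  -- `sinh` factor of the χ-distance and turns the other factor's norm into the `L²(p_θ)`-norm of
  -- `g`.
  have e1 : ∀ x, Real.exp (-u x) * g x - g x = Real.exp (-(1 / 2 * u x)) * g x *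
      (-fun x => 2 * Real.sinh (logRatio ref c φ θstar θ x / 2)) x := fun x => by
    have h1 : Real.exp (-u x) = Real.exp (-(u x / 2)) * Real.exp (-(u x / 2)) := by
      rw [← Real.exp_add]; ring_nf
    have h2 : Real.exp (u x / 2) * Real.exp (-(u x / 2)) = 1 := by rw [← Real.exp_add]; simp
    simp only [Pi.neg_apply, ← hu, Real.sinh_eq]
    rw [h1, show 1 / 2 * u x = u x / 2 by ring]
    linear_combination g x * h2
  have e2 : ∀ x, (Real.exp (-(1 / 2 * u x)) * g x) ^ 2 = Real.exp (-u x) * g x ^ 2 := fun x => by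
    rw [mul_pow, ← Real.exp_nat_mul]; ring_nf
  simp_rw [e1]
  refine hcs.trans (le_of_eq ?_)
  simp_rw [e2]
  simp [hu]

/-- Bias of the `m`-step chain for `p_θ` started at `p_{θ*}`. -/
lemma integral_law_sub_integral_bind_le (h : BoundedFamily ref c φ R) (θstar θ : Par d)
    {κ : Kernel 𝒳 𝒳} [IsMarkovKernel κ] (hκ : κ.Invariant (law ref c φ θ)) {f : 𝒳 → ℝ}
    (hf : Measurable f) {B : ℝ} (hB : ∀ x, |f x| ≤ B) (m : ℕ) :
    ∫ x, f x ∂law ref c φ θ - ∫ x, f x ∂((law ref c φ θstar).bind (κ ^ m)) ≤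
      l2Contraction κ (law ref c φ θ) ^ m * B * chiFun ref c φ θstar θ := by
  have hp := h.isProbabilityMeasure_law θ
  have hp' := h.isProbabilityMeasure_law θstar
  have hmk := isMarkovKernel_pow κ m
  set a := ∫ x, f x ∂law ref c φ θ with ha
  -- The constant `a` cancels in the difference of expectations, and centring is what lets the
  -- spectral gap act.
  set g : 𝒳 → ℝ := fun x => ∫ y, f y ∂((κ ^ m) x) - a with hg
  have hm0 : Measurable fun x => ∫ y, f y ∂((κ ^ m) x) := measurable_integral_kernel _ hf
  have hB0 : ∀ x, |∫ y, f y ∂((κ ^ m) x)| ≤ B := fun x => abs_integral_le_of_bound hB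
  have hgB : ∀ x, |g x| ≤ B + |a| := fun x => (abs_sub _ _).trans (by linarith [hB0 x])
  have hbind : ∀ θ', ∫ x, g x ∂law ref c φ θ' =
      ∫ x, f x ∂((law ref c φ θ').bind (κ ^ m)) - a := fun θ' => by
    have := h.isProbabilityMeasure_law θ'
    rw [hg, integral_sub (integrable_of_abs_le hm0 hB0) (integrable_const _),
      integral_bind_kernel (integrable_of_abs_le hf hB)]
    simp
  have h1 := h.integral_law_sub_le θstar θ (hm0.sub_const a) hgB
  change ∫ x, g x ∂_ - ∫ x, g x ∂_ ≤ _ at h1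
  rw [hbind, hbind, (invariant_pow hκ m).def] at h1
  have hchi : 0 ≤ chiFun ref c φ θstar θ := Real.sqrt_nonneg _
  have h2 := sqrt_integral_markov_pow_sub_sq_le hκ hf hB m
  have h3 : √(∫ x, (f x - a) ^ 2 ∂law ref c φ θ) ≤ B := by
    obtain ⟨x₀⟩ := nonempty_of_isProbabilityMeasure (law ref c φ θ)
    have hBn : 0 ≤ B := (abs_nonneg _).trans (hB x₀)
    refine Real.sqrt_le_iff.2 ⟨hBn, ?_⟩
    rw [ha, ← variance_eq_integral hf.aemeasurable]
    refine (variance_le_expectation_sq hf.aestronglyMeasurable).trans ?_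
    refine (le_abs_self _).trans (abs_integral_le_of_bound fun x => ?_)
    simp only [Pi.pow_apply, abs_pow]
    exact pow_le_pow_left₀ (abs_nonneg _) (hB x) 2
  calc _ ≤ _ := by linarith
    _ ≤ _ := mul_le_mul_of_nonneg_right (h2.trans (mul_le_mul_of_nonneg_left h3
      (pow_nonneg (l2Contraction_nonneg _ _) _))) hchi

end BoundedFamily

lemma norm_mean_le {d n : ℕ} {u : Fin n → Par d} {R : ℝ} (hR : 0 ≤ R) (h : ∀ i, ‖u i‖ ≤ R) :
    ‖(1 / (n : ℝ)) • ∑ i, u i‖ ≤ R := by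
  rw [norm_smul, Real.norm_of_nonneg (by positivity)]
  have h1 : ‖∑ i, u i‖ ≤ n * R := by
    simpa using norm_sum_le_of_le Finset.univ fun i _ => h i
  rcases n.eq_zero_or_pos with rfl | hn
  · simpa using hR
  · have hn' : (0 : ℝ) < n := Nat.cast_pos.2 hn
    rw [one_div_mul_eq_div, div_le_iff₀ hn']
    linarith

/-- The individual gaps bound the set by `1`, so `alphaSup` is a genuine supremum. -/
lemma pow_l2Contraction_le_alphaSup {𝒳 : Type*} [MeasurableSpace 𝒳] {d : ℕ} {ref : Measure 𝒳}
    {c : 𝒳 → ℝ} {φ : 𝒳 → Par d} {Θ : Set (Par d)} {k : Par d → Kernel 𝒳 𝒳}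
    (hk : ∀ θ ∈ Θ, l2Contraction (k θ) (law ref c φ θ) < 1) {θ : Par d} (hθ : θ ∈ Θ) (m : ℕ) :
    l2Contraction (k θ) (law ref c φ θ) ^ m ≤ alphaSup ref c φ Θ k ^ m := by
  refine pow_le_pow_left₀ (l2Contraction_nonneg _ _) ?_ m
  refine le_csSup ⟨1, ?_⟩ (Set.mem_image_of_mem _ hθ)
  rintro _ ⟨θ', hθ', rfl⟩
  exact (hk θ' hθ').le

lemma le_rpow_of_sqrt_mul_le {n : ℕ} (hn : 0 < n) {a γ : ℝ} (h : √n * a ≤ (n : ℝ) ^ γ) :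
    a ≤ (n : ℝ) ^ (-(1 / 2 : ℝ) + γ) := by
  have hn' : (0 : ℝ) < n := Nat.cast_pos.2 hn
  rw [Real.rpow_add hn', Real.rpow_neg hn'.le, ← Real.sqrt_eq_rpow, inv_mul_eq_div,
    le_div_iff₀ (Real.sqrt_pos.2 hn')]
  linarith

/-! ### Drift of the expected CD gradient. -/

namespace BoundedFamily

variable {𝒳 : Type*} [MeasurableSpace 𝒳] {d : ℕ} {ref : Measure 𝒳} {c : 𝒳 → ℝ}
  {φ : 𝒳 → Par d} {R : ℝ}

lemma integrable_stat (h : BoundedFamily ref c φ R) (μ : Measure 𝒳) [IsFiniteMeasure μ] :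
    Integrable φ μ :=
  Integrable.of_bound h.meas_stat.aestronglyMeasurable R (ae_of_all _ h.norm_le)

lemma norm_integral_stat_le (h : BoundedFamily ref c φ R) (μ : Measure 𝒳)
    [IsProbabilityMeasure μ] : ‖∫ y, φ y ∂μ‖ ≤ R := by
  simpa using norm_integral_le_of_norm_le_const (μ := μ) (ae_of_all _ h.norm_le)

lemma norm_empirical_sub_le (h : BoundedFamily ref c φ R) {Θ : Set (Par d)} {θstar : Par d}
    {k : Par d → Kernel 𝒳 𝒳} (hk : ∀ θ ∈ Θ, IsMarkovKernel (k θ)) {m n : ℕ} (hn : 0 < n)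
    {x : Fin n → 𝒳} {γ : ℝ} (h_emp : empiricalDeviation ref c φ Θ θstar k m x < (n : ℝ) ^ γ)
    {θ : Par d} (hθ : θ ∈ Θ) :
    ‖(1 / (n : ℝ)) • ∑ i, ∫ y, φ y ∂((k θ ^ m) (x i))
      - ∫ y, φ y ∂((law ref c φ θstar).bind (k θ ^ m : Kernel 𝒳 𝒳))‖
      ≤ (n : ℝ) ^ (-(1 / 2 : ℝ) + γ) := by
  refine le_rpow_of_sqrt_mul_le hn (le_trans ?_ h_emp.le)
  refine le_csSup ⟨√n * (R + R), ?_⟩ (Set.mem_image_of_mem _ hθ)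
  rintro _ ⟨θ', hθ', rfl⟩
  have := hk θ' hθ'
  have := isMarkovKernel_pow (k θ') m
  have := h.isProbabilityMeasure_law θstar
  refine mul_le_mul_of_nonneg_left ((norm_sub_le _ _).trans (add_le_add ?_ ?_))
    (Real.sqrt_nonneg _)
  · exact norm_mean_le h.nonneg_bound fun i => h.norm_integral_stat_le _
  · exact h.norm_integral_stat_le _

/-- The expected CD gradient points, up to bias and noise, towards the maximum likelihood
estimate. -/
lemma inner_expected_cdGradient_le {C : ℝ} (h : BoundedFamily ref c φ (√d * C))
    {Θ : Set (Par d)} (hΘb : Bornology.IsBounded Θ) (hΘ : Convex ℝ Θ) {θstar : Par d}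
    (hθs : θstar ∈ Θ) {k : Par d → Kernel 𝒳 𝒳} (hk_markov : ∀ θ ∈ Θ, IsMarkovKernel (k θ))
    (hk_inv : ∀ θ ∈ Θ, (k θ).Invariant (law ref c φ θ))
    (hk_gap : ∀ θ ∈ Θ, l2Contraction (k θ) (law ref c φ θ) < 1) {m n : ℕ} (hn : 0 < n) {γ : ℝ}
    {x : Fin n → 𝒳} (hx : ∀ i, 0 < c (x i)) {θhat : Par d} (hm : IsMLE ref c φ Θ x θhat)
    (h_mle : √n * ‖θhat - θstar‖ < (n : ℝ) ^ γ)
    (h_emp : empiricalDeviation ref c φ Θ θstar k m x < (n : ℝ) ^ γ)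
    {θ : Par d} (hθ : θ ∈ Θ) :
    inner ℝ (θ - θhat) ((1 / (n : ℝ)) • ∑ i, φ (x i)
        - (1 / (n : ℝ)) • ∑ i, ∫ y, φ y ∂((k θ ^ m) (x i))) ≤
      -(aCoef d m (lam ref c φ Θ) C (lipConst ref c φ Θ θstar) (alphaSup ref c φ Θ k)
          * ‖θ - θhat‖ ^ 2
        - bCoef d n m C (lipConst ref c φ Θ θstar) (alphaSup ref c φ Θ k) γ * ‖θ - θhat‖) := by
  have := hk_markov θ hθ
  have := isMarkovKernel_pow (k θ) m
  have := h.isProbabilityMeasure_law θstar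
  have h_lik := h.inner_likelihood_gradient_le hΘ hx hn hm hθ
  have h_bias := h.integral_law_sub_integral_bind_le θstar θ (hk_inv θ hθ)
    (h.measurable_inner (θ - θhat)) (h.abs_inner_le (θ - θhat)) m
  have h_noise := h.norm_empirical_sub_le hk_markov hn h_emp hθ
  have h_chi := h.chiFun_le_lipConst_mul hΘb hθs hθ
  have h_pow := pow_l2Contraction_le_alphaSup (ref := ref) (c := c) (φ := φ) hk_gap hθ m
  have hR := h.nonneg_bound
  set v := θ - θhat
  set δ := (n : ℝ) ^ (-(1 / 2 : ℝ) + γ)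
  set L := lipConst ref c φ Θ θstar
  set A := alphaSup ref c φ Θ k ^ m
  set W := ∫ y, φ y ∂((law ref c φ θstar).bind (k θ ^ m : Kernel 𝒳 𝒳)) with hW
  set E := (1 / (n : ℝ)) • ∑ i, ∫ y, φ y ∂((k θ ^ m) (x i))
  have hL : 0 ≤ L := NNReal.coe_nonneg _
  have hA : 0 ≤ A := (pow_nonneg (l2Contraction_nonneg _ _) m).trans h_pow
  -- The bias scales with the distance to `θ*`; replacing it by the distance to `θhat` costs `δ`,
  -- whence the term `√d C L α^m` in `bCoef`.
  have h_dist : ‖θ - θstar‖ ≤ ‖v‖ + δ := by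
    have h1 : ‖θhat - θstar‖ ≤ δ := le_rpow_of_sqrt_mul_le hn h_mle.le
    calc ‖θ - θstar‖ = ‖v + (θhat - θstar)‖ := by congr 1; simp only [v]; abel
      _ ≤ _ := (norm_add_le _ _).trans (by gcongr)
  have h_bias' : l2Contraction (k θ) (law ref c φ θ) ^ m * (‖v‖ * (√d * C))
      * chiFun ref c φ θstar θ ≤ A * (‖v‖ * (√d * C)) * (L * (‖v‖ + δ)) := by
    refine mul_le_mul (mul_le_mul_of_nonneg_right h_pow (by positivity))
      (h_chi.trans (mul_le_mul_of_nonneg_left h_dist hL)) (Real.sqrt_nonneg _) (by positivity)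
  have h_noise' : -inner ℝ v (E - W) ≤ ‖v‖ * δ := by
    refine (neg_le_abs _).trans ((abs_real_inner_le_norm _ _).trans ?_)
    gcongr
  rw [integral_inner (h.integrable_stat _)
    (μ := (law ref c φ θstar).bind (k θ ^ m : Kernel 𝒳 𝒳)), ← hW] at h_bias
  rw [inner_sub_right] at h_noise' ⊢
  rw [real_inner_smul_right, inner_sum]
  simp only [aCoef, bCoef]
  nlinarith

end BoundedFamily

/-! ### Conditional expectations from set-wise conditional laws. -/

section ConditionalLaw

variable {Ω β E : Type*} {m m₀ : MeasurableSpace Ω} [MeasurableSpace β] {P : Measure Ω}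
  [NormedAddCommGroup E] [NormedSpace ℝ E] [CompleteSpace E]

lemma condExp_simpleFunc_comp_eq_integral [IsProbabilityMeasure P] {Y : Ω → β}
    (hY : Measurable Y) {μ : Ω → Measure β} (hμ : ∀ ω, IsProbabilityMeasure (μ ω))
    (hlaw : ∀ A, MeasurableSet A → P⟦Y ⁻¹' A | m⟧ =ᵐ[P] fun ω => (μ ω).real A)
    (f : SimpleFunc β E) :
    P[fun ω => f (Y ω) | m] =ᵐ[P] fun ω => ∫ y, f y ∂(μ ω) := by
  induction f using SimpleFunc.induction with
  | const c hA =>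
    classical
    rename_i A
    have hi : Integrable ((Y ⁻¹' A).indicator fun _ => (1 : ℝ)) P :=
      (integrable_const _).indicator (hY hA)
    have h1 : (fun ω => (SimpleFunc.piecewise A hA (SimpleFunc.const β c)
        (SimpleFunc.const β 0)) (Y ω)) =
        ((Y ⁻¹' A).indicator fun _ => (1 : ℝ)) • fun _ => c := by
      funext ω
      by_cases h : Y ω ∈ A <;> simp [h, Set.piecewise]
    have h2 : ∀ ω, ∫ y, (SimpleFunc.piecewise A hA (SimpleFunc.const β c)
        (SimpleFunc.const β 0)) y ∂(μ ω) = (μ ω).real A • c := fun ω => by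
      have : (⇑(SimpleFunc.piecewise A hA (SimpleFunc.const β c) (SimpleFunc.const β 0)) : β → E) =
          A.indicator fun _ => c := by
        simp only [SimpleFunc.coe_piecewise, SimpleFunc.coe_const]
        exact Set.piecewise_eq_indicator
      rw [this, integral_indicator_const _ hA]
    simp_rw [h1, h2]
    have h3 := condExp_smul_of_aestronglyMeasurable_right (m := m) (μ := P) (g := fun _ => c)
      hi (hi.smul_const c)
      aestronglyMeasurable_const
    filter_upwards [h3, hlaw A hA] with ω h4 h5
    rw [h4, Pi.smul_apply', h5]
  | add _ hf hg =>
    rename_i f g _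
    have hif : ∀ f : SimpleFunc β E, Integrable (fun ω => f (Y ω)) P := fun f =>
      (f.comp Y hY).integrable_of_isFiniteMeasure
    have hiμ : ∀ (f : SimpleFunc β E) ω, Integrable f (μ ω) := fun f ω =>
      f.integrable_of_isFiniteMeasure
    filter_upwards [hf, hg, condExp_add (hif f) (hif g) m] with ω h1 h2 h3
    simp only [SimpleFunc.coe_add, Pi.add_apply]
    rw [integral_add (hiμ f ω) (hiμ g ω), ← h1, ← h2]
    exact h3

/-- If the conditional probabilities of `Y` are given by the measures `μ ω`, then so are the
conditional expectations of bounded functions of `Y`. -/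
lemma condExp_comp_eq_integral [IsProbabilityMeasure P] (hm : m ≤ m₀) {Y : Ω → β}
    (hY : Measurable Y) {μ : Ω → Measure β} (hμ : ∀ ω, IsProbabilityMeasure (μ ω))
    (hlaw : ∀ A, MeasurableSet A → P⟦Y ⁻¹' A | m⟧ =ᵐ[P] fun ω => (μ ω).real A)
    {g : β → E} (hg : StronglyMeasurable g) {B : ℝ} (hB : ∀ y, ‖g y‖ ≤ B) :
    P[fun ω => g (Y ω) | m] =ᵐ[P] fun ω => ∫ y, g y ∂(μ ω) := by
  set f : ℕ → SimpleFunc β E := hg.approxBounded B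
  have hft : ∀ y, Filter.Tendsto (fun j => f j y) Filter.atTop (nhds (g y)) := fun y =>
    hg.tendsto_approxBounded_of_norm_le (hB y)
  have hB0 : 0 ≤ max B 0 := le_max_right _ _
  have hfb : ∀ j y, ‖f j y‖ ≤ max B 0 := by
    rcases isEmpty_or_nonempty β with hβ | ⟨⟨y₀⟩⟩
    · exact fun j y => hβ.elim y
    · exact fun j y =>
        (hg.norm_approxBounded_le ((norm_nonneg _).trans (hB y₀)) j y).trans (le_max_left _ _)
  have hs := fun j => condExp_simpleFunc_comp_eq_integral hY hμ hlaw (f j)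
  have hlim : ∀ ω, Filter.Tendsto (fun j => ∫ y, f j y ∂(μ ω)) Filter.atTop
      (nhds (∫ y, g y ∂(μ ω))) := fun ω =>
    tendsto_integral_of_dominated_convergence (fun _ => max B 0)
      (fun j => (f j).aestronglyMeasurable) (integrable_const _)
      (fun j => ae_of_all _ (hfb j)) (ae_of_all _ hft)
  have hsm : ∀ j, AEStronglyMeasurable[m] (fun ω => ∫ y, f j y ∂(μ ω)) P := fun j =>
    ⟨_, stronglyMeasurable_condExp, (hs j).symm⟩
  -- No measurability of `μ` is given; an `m`-measurable version is the limit of the conditional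
  -- expectations of the simple approximations.
  have hgm : AEStronglyMeasurable[m] (fun ω => ∫ y, g y ∂(μ ω)) P := by
    have hl : StronglyMeasurable[m] fun ω =>
        Filter.limUnder Filter.atTop fun j => (P[fun ω => f j (Y ω) | m]) ω :=
      @StronglyMeasurable.limUnder _ _ _ m _ _ _ _ _ _ _ fun _ => stronglyMeasurable_condExp
    refine ⟨_, hl, ?_⟩
    filter_upwards [ae_all_iff.2 hs] with ω hω
    simp_rw [hω]
    exact (hlim ω).limUnder_eq.symm
  have hib : ∀ ω, ‖∫ y, g y ∂(μ ω)‖ ≤ max B 0 := fun ω => by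
    simpa using norm_integral_le_of_norm_le_const (μ := μ ω)
      (ae_of_all _ fun y => (hB y).trans (le_max_left B 0))
  have hint : Integrable (fun ω => ∫ y, g y ∂(μ ω)) P :=
    Integrable.of_bound (hgm.mono hm) (max B 0) (ae_of_all _ hib)
  have hfib : ∀ j ω, ‖∫ y, f j y ∂(μ ω)‖ ≤ max B 0 := fun j ω => by
    simpa using norm_integral_le_of_norm_le_const (μ := μ ω) (ae_of_all _ (hfb j))
  have hfint : ∀ j, Integrable (fun ω => ∫ y, f j y ∂(μ ω)) P := fun j =>
    Integrable.of_bound ((hsm j).mono hm) (max B 0) (ae_of_all _ (hfib j))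
  -- Both bounded sequences have the same conditional expectations, hence so do their limits.
  refine (tendsto_condExp_unique (fun j ω => f j (Y ω)) (fun j ω => ∫ y, f j y ∂(μ ω))
    (fun ω => g (Y ω)) (fun ω => ∫ y, g y ∂(μ ω))
    (fun j => ((f j).comp Y hY).integrable_of_isFiniteMeasure) hfint
    (ae_of_all _ fun ω => hft (Y ω)) (ae_of_all _ hlim) (fun _ => max B 0) (integrable_const _)
    (fun _ => max B 0) (integrable_const _) (fun j => ae_of_all _ fun ω => hfb j (Y ω))
    (fun j => ae_of_all _ (hfib j)) fun j => ?_).trans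
    (condExp_of_aestronglyMeasurable' hm hgm hint)
  exact (hs j).trans (condExp_of_aestronglyMeasurable' hm (hsm j) (hfint j)).symm

end ConditionalLaw

/-! ### The stochastic recursion. -/

/-- The distance to the complement is attained on the frontier, so a step leaving `Θ` is at least as
long as the distance to `∂Θ`; the layer's width is the largest possible step. -/
lemma add_smul_mem_of_notMem_boundaryLayer {d : ℕ} {Θ : Set (Par d)} {C η : ℝ}
    (hη : 0 ≤ η) {θ g : Par d} (hθ : θ ∈ Θ) (hb : θ ∉ boundaryLayer Θ C η)
    (hg : ‖g‖ ≤ 2 * (√d * C)) : θ + η • g ∈ Θ := by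
  have hd : 2 * η * √d * C < Metric.infDist θ (frontier Θ) := by
    by_contra hcon
    exact hb ⟨hθ, not_lt.1 hcon⟩
  by_contra hmem
  obtain ⟨y, hy, hyd⟩ := exists_mem_frontier_infDist_compl_eq_dist hθ
    fun h : Θ = Set.univ => hmem (h ▸ Set.mem_univ _)
  have h1 : Metric.infDist θ (frontier Θ) ≤ ‖η • g‖ := by
    calc Metric.infDist θ (frontier Θ) ≤ dist θ y := Metric.infDist_le_dist_of_mem hy
      _ = Metric.infDist θ Θᶜ := hyd.symm
      _ ≤ dist θ (θ + η • g) := Metric.infDist_le_dist_of_mem hmem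
      _ = ‖η • g‖ := by simp
  rw [norm_smul, Real.norm_of_nonneg hη] at h1
  have := mul_le_mul_of_nonneg_left hg hη
  linarith

lemma measurableSet_boundaryLayer {d : ℕ} {Θ : Set (Par d)} (hΘ : IsClosed Θ) (C η : ℝ) :
    MeasurableSet (boundaryLayer Θ C η) :=
  (hΘ.inter (isClosed_le (Metric.continuous_infDist_pt _) continuous_const)).measurableSet

/-- One step of a stochastic recursion: conditioning a bound with a linear term first on the
whole past `F`, then on a smaller `σ`-algebra. -/
lemma condExp_le_of_le_add_inner {Ω E : Type*} {σ F m₀ : MeasurableSpace Ω} {P : Measure Ω}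
    [IsProbabilityMeasure P] [NormedAddCommGroup E] [InnerProductSpace ℝ E] [CompleteSpace E]
    (hσF : σ ≤ F) (hF : F ≤ m₀) {Z S H : Ω → ℝ} {V G G' : Ω → E} (hZ : Integrable Z P)
    (hS : Integrable S P) (hSF : StronglyMeasurable[F] S) (hVF : StronglyMeasurable[F] V)
    (hG : Integrable G P) (hVG : Integrable (fun ω => inner ℝ (V ω) (G ω)) P)
    (hH : Integrable H P) (hHσ : StronglyMeasurable[σ] H) (hGG' : P[G | F] =ᵐ[P] G')
    (hZle : ∀ ω, Z ω ≤ S ω + inner ℝ (V ω) (G ω))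
    (hle : ∀ ω, S ω + inner ℝ (V ω) (G' ω) ≤ H ω) : P[Z | σ] ≤ᵐ[P] H := by
  have hpull : P[fun ω => inner ℝ (V ω) (G ω) | F] =ᵐ[P] fun ω => inner ℝ (V ω) ((P[G | F]) ω) :=
    condExp_bilin_of_stronglyMeasurable_left (innerSL ℝ) hVF hVG hG
  have hstep : P[Z | F] ≤ᵐ[P] H := by
    filter_upwards [condExp_mono (m := F) hZ (hS.add hVG) (ae_of_all _ hZle),
      condExp_add hS hVG F, hpull, hGG'] with ω h1 h2 h3 h4
    refine h1.trans ?_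
    rw [h2, Pi.add_apply, condExp_of_stronglyMeasurable hF hSF hS, h3, h4]
    exact hle ω
  have hmono := condExp_mono (m := σ) integrable_condExp hH hstep
  rw [condExp_of_stronglyMeasurable (hσF.trans hF) hHσ hH] at hmono
  exact (condExp_condExp_of_le hσF hF).symm.le.trans hmono

section Gradient

variable {𝒳 : Type*} {d n : ℕ} {φ : 𝒳 → Par d} {R : ℝ}

lemma norm_cdGradient_le (hR : 0 ≤ R) (hφ : ∀ x, ‖φ x‖ ≤ R) (x y : Fin n → 𝒳) :
    ‖cdGradient φ x y‖ ≤ 2 * R := by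
  rw [two_mul]
  exact (norm_sub_le _ _).trans
    (add_le_add (norm_mean_le hR fun i => hφ _) (norm_mean_le hR fun i => hφ _))

lemma measurable_cdGradient [MeasurableSpace 𝒳] (hφ : Measurable φ) (x : Fin n → 𝒳) :
    Measurable (cdGradient φ x) := by
  unfold cdGradient
  fun_prop

/-- The gradient is a sum over coordinates, so only the marginals of the product law enter. -/
lemma integral_cdGradient_pi [MeasurableSpace 𝒳] (hφm : Measurable φ) (hφ : ∀ x, ‖φ x‖ ≤ R) (x : Fin n → 𝒳)
    (μ : Fin n → Measure 𝒳) [∀ i, IsProbabilityMeasure (μ i)] :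
    ∫ y, cdGradient φ x y ∂(Measure.pi μ) =
      (1 / (n : ℝ)) • ∑ i, φ (x i) - (1 / (n : ℝ)) • ∑ i, ∫ z, φ z ∂(μ i) := by
  have hi : ∀ i, Integrable (fun y : Fin n → 𝒳 => φ (y i)) (Measure.pi μ) := fun i =>
    Integrable.of_bound (hφm.comp (measurable_pi_apply i)).aestronglyMeasurable R
      (ae_of_all _ fun y => hφ _)
  have hpi : ∀ i, ∫ y : Fin n → 𝒳, φ (y i) ∂(Measure.pi μ) = ∫ z, φ z ∂(μ i) := fun i => by
    have hmp := measurePreserving_eval μ i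
    rw [← hmp.map_eq, integral_map (measurable_pi_apply i).aemeasurable
      hφm.aestronglyMeasurable]
  simp only [cdGradient]
  have hs : Integrable (fun y : Fin n → 𝒳 => (1 / (n : ℝ)) • ∑ i, φ (y i)) (Measure.pi μ) :=
    (integrable_finsetSum Finset.univ fun i _ => hi i).smul (1 / (n : ℝ))
  rw [integral_sub (integrable_const _) hs, integral_const, probReal_univ, one_smul, integral_smul,
    integral_finsetSum _ fun i _ => hi i]
  simp [hpi]

end Gradient

namespace IsCDRun

variable {𝒳 : Type*} [MeasurableSpace 𝒳] {d n : ℕ} {Ω : Type*} [MeasurableSpace Ω]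
  {P : Measure Ω} {φ : 𝒳 → Par d} {Θ : Set (Par d)} {C : ℝ} {k : Par d → Kernel 𝒳 𝒳} {m : ℕ}
  {η : ℕ → ℝ} {x : Fin n → 𝒳} {θ : ℕ → Ω → Par d} {Y : ℕ → Ω → Fin n → 𝒳}

lemma param_mem (h : IsCDRun P φ Θ C k m η x θ Y) (hη : ∀ t, 0 ≤ η t) (hR : 0 ≤ √d * C)
    (hφ : ∀ x, ‖φ x‖ ≤ √d * C) (t : ℕ) (ω : Ω) : θ t ω ∈ Θ := by
  induction t with
  | zero => exact h.init_mem ω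
  | succ t ih =>
    rw [h.update]
    by_cases hb : θ t ω ∈ boundaryLayer Θ C (η t)
    · simpa [hb] using ih
    · rw [Set.indicator_of_mem (show θ t ω ∈ (boundaryLayer Θ C (η t))ᶜ from hb)]
      exact add_smul_mem_of_notMem_boundaryLayer (hη t) ih hb (norm_cdGradient_le hR hφ _ _)

/-- Off the layer this is the expanded square; on it the parameter stays put and the last term is
slack. -/
lemma norm_sq_update_le (h : IsCDRun P φ Θ C k m η x θ Y) (hR : 0 ≤ √d * C)
    (hφ : ∀ x, ‖φ x‖ ≤ √d * C) (θhat : Par d) (t : ℕ) (ω : Ω) :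
    ‖θ (t + 1) ω - θhat‖ ^ 2 ≤ ‖θ t ω - θhat‖ ^ 2
      + inner ℝ ((2 * η t * (boundaryLayer Θ C (η t))ᶜ.indicator 1 (θ t ω)) • (θ t ω - θhat))
          (cdGradient φ x (Y t ω))
      + 4 * d * η t ^ 2 * C ^ 2 := by
  rw [h.update]
  set g := cdGradient φ x (Y t ω)
  have hg : ‖g‖ ^ 2 ≤ 4 * d * C ^ 2 := by
    have h1 := pow_le_pow_left₀ (norm_nonneg _) (norm_cdGradient_le hR hφ x (Y t ω)) 2
    rwa [mul_pow, mul_pow, Real.sq_sqrt (Nat.cast_nonneg d), ← mul_assoc,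
      show (2 : ℝ) ^ 2 = 4 by norm_num] at h1
  have hg' : η t ^ 2 * ‖g‖ ^ 2 ≤ 4 * d * η t ^ 2 * C ^ 2 := by
    have := mul_le_mul_of_nonneg_left hg (sq_nonneg (η t))
    linarith
  by_cases hb : θ t ω ∈ (boundaryLayer Θ C (η t))ᶜ
  · rw [Set.indicator_of_mem hb, Set.indicator_of_mem hb, add_sub_right_comm,
      norm_add_sq_real, real_inner_smul_right, real_inner_smul_left, norm_smul, mul_pow,
      Real.norm_eq_abs, sq_abs, Pi.one_apply]
    linarith
  · rw [Set.indicator_of_notMem hb, Set.indicator_of_notMem hb]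
    have : 0 ≤ η t ^ 2 * ‖g‖ ^ 2 := by positivity
    simp only [add_zero, mul_zero, zero_smul, inner_zero_left]
    linarith

end IsCDRun
end CD

theorem mainTheorem4 {𝒳 : Type*} [MeasurableSpace 𝒳] {d n : ℕ}
    (ref : Measure 𝒳) (c : 𝒳 → ℝ) (φ : 𝒳 → CD.Par d)
    (Θ : Set (CD.Par d)) (θstar : CD.Par d) (C : ℝ)
    -- the exponential family
    (hc_meas : Measurable c) (hc_nonneg : ∀ x, 0 ≤ c x) (hφ_meas : Measurable φ)
    (h_int : Integrable (fun x => c x * Real.exp (inner ℝ θstar (φ x))) ref)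
    (h_pos : 0 < ∫ x, c x * Real.exp (inner ℝ θstar (φ x)) ∂ref)
    -- bounded sufficient statistic
    (hC : ∀ x j, |φ x j| ≤ C)
    -- the parameter space
    (hΘ_compact : IsCompact Θ) (hΘ_convex : Convex ℝ Θ) (hθstar : θstar ∈ interior Θ)
    -- linear independence of the sufficient statistics under each `p_θ`
    (h_indep : ∀ θ ∈ Θ, ∀ v : CD.Par d,
      (∀ᵐ x ∂(CD.law ref c φ θ), ∑ j, v j * φ x j = 0) → v = 0)
    -- Markov kernels with invariant laws `p_θ` and a uniform `L²`-spectral gap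
    (k : CD.Par d → Kernel 𝒳 𝒳) (hk_markov : ∀ θ ∈ Θ, IsMarkovKernel (k θ))
    (hk_inv : ∀ θ ∈ Θ, (k θ).Invariant (CD.law ref c φ θ))
    (hk_gap : ∀ θ ∈ Θ, CD.l2Contraction (k θ) (CD.law ref c φ θ) < 1)
    (hk_gap_sup : CD.alphaSup ref c φ Θ k < 1)
    -- the data sample, the maximum likelihood estimate, and the two data constraints
    (m : ℕ) (γ : ℝ) (hγ_pos : 0 < γ) (hγ_lt : γ < 1 / 2)
    (x : Fin n → 𝒳) (hx : ∀ i, 0 < c (x i))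
    (θhat : CD.Par d) (hθhat : CD.IsMLE ref c φ Θ x θhat)
    (h_mle : Real.sqrt n * ‖θhat - θstar‖ < (n : ℝ) ^ γ)
    (h_emp : CD.empiricalDeviation ref c φ Θ θstar k m x < (n : ℝ) ^ γ)
    -- the CD-`m` run on the data `x`
    (η : ℕ → ℝ) (hη : ∀ t, 0 ≤ η t)
    {Ω : Type*} [MeasurableSpace Ω] (P : Measure Ω) [IsProbabilityMeasure P]
    (θ : ℕ → Ω → CD.Par d) (Y : ℕ → Ω → Fin n → 𝒳)
    (h_run : CD.IsCDRun P φ Θ C k m η x θ Y) (t : ℕ) :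
    Integrable (fun ω => ‖θ (t + 1) ω - θhat‖ ^ 2) P ∧
    P[fun ω => ‖θ (t + 1) ω - θhat‖ ^ 2 | MeasurableSpace.comap (θ t) inferInstance] ≤ᵐ[P]
      fun ω => ‖θ t ω - θhat‖ ^ 2
        - 2 * η t *
          (CD.aCoef d m (CD.lam ref c φ Θ) C (CD.lipConst ref c φ Θ θstar)
              (CD.alphaSup ref c φ Θ k) * ‖θ t ω - θhat‖ ^ 2
            - CD.bCoef d n m C (CD.lipConst ref c φ Θ θstar) (CD.alphaSup ref c φ Θ k) γ
              * ‖θ t ω - θhat‖)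
          * (CD.boundaryLayer Θ C (η t))ᶜ.indicator 1 (θ t ω)
        + 4 * d * (η t) ^ 2 * C ^ 2 := by
  -- For `n = 0` the first data constraint would read `0 < 0`.
  have hn : 0 < n := by
    rcases n.eq_zero_or_pos with rfl | hn
    · simp [Real.zero_rpow hγ_pos.ne'] at h_mle
    · exact hn
  have hφ : ∀ y, ‖φ y‖ ≤ √d * C := fun y => by
    -- For `d = 0` the sign of `C` is free, but `√d * C` vanishes.
    rcases d.eq_zero_or_pos with rfl | hd
    · simp [Subsingleton.elim (φ y) 0]
    · have hC0 : 0 ≤ C := (abs_nonneg _).trans (hC y ⟨0, hd⟩)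
      rw [EuclideanSpace.norm_eq, Real.sqrt_le_left (by positivity), mul_pow,
        Real.sq_sqrt (Nat.cast_nonneg d)]
      calc ∑ j, ‖φ y j‖ ^ 2 ≤ ∑ _j : Fin d, C ^ 2 :=
            Finset.sum_le_sum fun j _ => pow_le_pow_left₀ (norm_nonneg _) (hC y j) 2
        _ = _ := by simp
  have hF : CD.BoundedFamily ref c φ (√d * C) :=
    ⟨hc_meas, hc_nonneg, hφ_meas, hφ, θstar, h_int, h_pos⟩
  have hR := hF.nonneg_bound
  have hmem : ∀ t ω, θ t ω ∈ Θ := h_run.param_mem hη hR hφ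
  obtain ⟨D, hD⟩ := hΘ_compact.isBounded.subset_closedBall θhat
  have hdist : ∀ t ω, ‖θ t ω - θhat‖ ≤ D := fun t ω => by
    simpa [dist_eq_norm] using hD (hmem t ω)
  have hmeasΘ := h_run.measurable_param
  have hsq_int : ∀ t, Integrable (fun ω => ‖θ t ω - θhat‖ ^ 2) P := fun t => by
    refine Integrable.of_bound (((hmeasΘ t).sub_const θhat).norm.pow_const 2).aestronglyMeasurable
      (D ^ 2) (ae_of_all _ fun ω => ?_)
    rw [norm_pow, norm_norm]
    exact pow_le_pow_left₀ (norm_nonneg _) (hdist t ω) 2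
  refine ⟨hsq_int (t + 1), ?_⟩
  set a := CD.aCoef d m (CD.lam ref c φ Θ) C (CD.lipConst ref c φ Θ θstar)
    (CD.alphaSup ref c φ Θ k)
  set b := CD.bCoef d n m C (CD.lipConst ref c φ Θ θstar) (CD.alphaSup ref c φ Θ k) γ
  set I : CD.Par d → ℝ := (CD.boundaryLayer Θ C (η t))ᶜ.indicator 1
  have hI_meas : Measurable I :=
    measurable_one.indicator (CD.measurableSet_boundaryLayer hΘ_compact.isClosed C _).compl
  have hI_nonneg : ∀ v, 0 ≤ I v := fun v => Set.indicator_nonneg (fun _ _ => zero_le_one) v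
  have hI_le : ∀ v, I v ≤ 1 := fun v => Set.indicator_le_self' (fun _ _ => zero_le_one) v
  have hF_le : ⨆ s ≤ t, MeasurableSpace.comap (θ s) inferInstance ≤ ‹MeasurableSpace Ω› :=
    iSup₂_le fun s _ => (hmeasΘ s).comap_le
  have hσF : MeasurableSpace.comap (θ t) inferInstance ≤
      ⨆ s ≤ t, MeasurableSpace.comap (θ s) inferInstance :=
    le_iSup₂_of_le (f := fun s (_ : s ≤ t) => MeasurableSpace.comap (θ s) inferInstance) t le_rfl
      le_rfl
  set μ : Ω → Measure (Fin n → 𝒳) := fun ω => Measure.pi fun i => (k (θ t ω) ^ m) (x i)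
  have hprob : ∀ ω i, IsProbabilityMeasure ((k (θ t ω) ^ m) (x i)) := fun ω i => by
    have := hk_markov _ (hmem t ω)
    have := CD.isMarkovKernel_pow (k (θ t ω)) m
    infer_instance
  have hG := CD.condExp_comp_eq_integral hF_le (h_run.measurable_sample t) (μ := μ)
    (fun ω => inferInstance) (h_run.sample_law t)
    (CD.measurable_cdGradient hφ_meas x).stronglyMeasurable (CD.norm_cdGradient_le hR hφ x)
  set G : Ω → CD.Par d := fun ω => CD.cdGradient φ x (Y t ω)
  have hG_int : Integrable G P := Integrable.of_bound
    ((CD.measurable_cdGradient hφ_meas x).comp (h_run.measurable_sample t)).aestronglyMeasurable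
    _ (ae_of_all _ fun ω => CD.norm_cdGradient_le hR hφ x _)
  -- The coefficient of the gradient in the cross term, a function of `θ_t` alone.
  set V : CD.Par d → CD.Par d := fun v => (2 * η t * I v) • (v - θhat)
  have hV_meas : Measurable V := (hI_meas.const_mul _).smul (measurable_id.sub_const θhat)
  have hθF : Measurable[⨆ s ≤ t, MeasurableSpace.comap (θ s) inferInstance] (θ t) :=
    (comap_measurable (θ t)).mono hσF le_rfl
  have hVG_int : Integrable (fun ω => inner ℝ (V (θ t ω)) (G ω)) P := by
    refine (hG_int.norm.const_mul (2 * η t * D)).mono'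
      (((hV_meas.comp (hmeasΘ t)).aestronglyMeasurable).inner hG_int.1) (ae_of_all _ fun ω => ?_)
    refine (norm_inner_le_norm _ _).trans (mul_le_mul_of_nonneg_right ?_ (norm_nonneg _))
    have h2 : 0 ≤ 2 * η t := by have := hη t; positivity
    simp only [V]
    rw [norm_smul, Real.norm_of_nonneg (mul_nonneg h2 (hI_nonneg _))]
    exact mul_le_mul (mul_le_of_le_one_right h2 (hI_le _)) (hdist t ω) (norm_nonneg _) h2
  set K : ℝ := 4 * d * η t ^ 2 * C ^ 2
  set H : CD.Par d → ℝ := fun v => ‖v - θhat‖ ^ 2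
    - 2 * η t * (a * ‖v - θhat‖ ^ 2 - b * ‖v - θhat‖) * I v + K
  have hH_meas : Measurable H := by
    simp only [H]
    fun_prop
  have hH_int : Integrable (fun ω => H (θ t ω)) P := by
    have hn_int : Integrable (fun ω => ‖θ t ω - θhat‖) P :=
      Integrable.of_bound ((hmeasΘ t).sub_const θhat).norm.aestronglyMeasurable D
        (ae_of_all _ fun ω => by simpa using hdist t ω)
    have hq : Integrable (fun ω => 2 * η t * (a * ‖θ t ω - θhat‖ ^ 2 - b * ‖θ t ω - θhat‖)) P :=
      (((hsq_int t).const_mul a).sub (hn_int.const_mul b)).const_mul _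
    have hqI : Integrable (fun ω => 2 * η t * (a * ‖θ t ω - θhat‖ ^ 2 - b * ‖θ t ω - θhat‖)
        * I (θ t ω)) P := by
      refine hq.mono (hq.1.mul (hI_meas.comp (hmeasΘ t)).aestronglyMeasurable)
        (ae_of_all _ fun ω => ?_)
      rw [norm_mul, Real.norm_of_nonneg (hI_nonneg _)]
      exact mul_le_of_le_one_right (norm_nonneg _) (hI_le _)
    exact ((hsq_int t).sub hqI).add (integrable_const K)
  refine CD.condExp_le_of_le_add_inner (S := fun ω => ‖θ t ω - θhat‖ ^ 2 + K)
    (H := fun ω => H (θ t ω)) (V := fun ω => V (θ t ω)) (G := G) hσF hF_le (hsq_int (t + 1))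
    ((hsq_int t).add (integrable_const K)) ?_ (hV_meas.comp hθF).stronglyMeasurable hG_int hVG_int
    hH_int (hH_meas.comp (comap_measurable (θ t))).stronglyMeasurable hG (fun ω => ?_) fun ω => ?_
  · exact ((((measurable_id.sub_const θhat).norm.pow_const 2).add_const K).comp
      hθF).stronglyMeasurable
  · have := h_run.norm_sq_update_le hR hφ θhat t ω
    simp only [V, K, G, I]
    linarith
  · have h1 := CD.integral_cdGradient_pi hφ_meas hφ x fun i => (k (θ t ω) ^ m) (x i)
    have h2 := hF.inner_expected_cdGradient_le hΘ_compact.isBounded hΘ_convex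
      (interior_subset hθstar) hk_markov hk_inv hk_gap hn hx hθhat h_mle h_emp (hmem t ω)
    rw [← h1] at h2
    have h3 := mul_le_mul_of_nonneg_left h2
      (mul_nonneg (mul_nonneg zero_le_two (hη t)) (hI_nonneg (θ t ω)))
    simp only [V, H, real_inner_smul_left]
    linarith
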